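/- **Setting.** $\mathbb R^d$ carries the sup norm, $B_r(x)$ is the closed ball, and $\mathcal P(\mathbb R^d)$ is the space of Borel probability measures. A *box* $B\subseteq\mathbb R^d$ is a product of $d$ bounded intervals of positive length, each open, closed or half-open. Let $T_B(x)=\operatorname{vol}(B)^{-1/d}(x-\min\overline B)$, where $\min\overline B$ is the lower left corner, and let $B^*=T_BB$, a box of volume $1$. For $\mu(B)>0$ let $\mu^B=T_B\big(\mu(B)^{-1}\mu|_B\big)$, a probability measure on $B^*$. A *partition operator* $\Delta$ on a family $\mathcal E$ of boxes assigns to each $E\in\mathcal E$ a partition $\Delta E\subseteq\mathcal E$ of $E$ such that $\Delta(SE)=S(\Delta E)$ whenever $Sx=ax+b$ with $a>0$ and $E,SE\in\mathcal E$. Put $\Delta^0B=\{B\}$ and $\Delta^{n+1}B=\bigcup_{E\in\Delta^nB}\Delta E$. For $0<\rho<1$, $\Delta$ is *$\rho$-regular* if for each $B\in\mathcal E$ there is $C>1$ such that for all $n\ge1$ every element of $\Delta^nB$ contains a ball of radius $\rho^n/C$ and is contained in a ball of radius $C\rho^n$. A *CP-chain* for $\Delta$ is a stationary Markov process $(\mu_n,B_n)_{n}$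 of pairs in which $B_n,B_n^*\in\mathcal E$ and $\mu_n$ is a probability measure with $\mu_n(B_n^*)=1$, with transition law $$(\mu,A)\mapsto(\mu^B,B)\ \text{ with probability } \mu(B),\qquad B\in\Delta(A^*).$$ It is *ergodic* if its distribution $P$ on sequences is ergodic for the shift. We also write $P$ for the distribution of a single measure $\mu_n$. For $\nu\in\mathcal P(\mathbb R^k)$ let $\dim_*\nu=\inf\{\dim A: A \text{ Borel},\ \nu(A)>0\}$, where $\dim A$ is the Hausdorff dimension, and $H_r(\nu)=-\int\log\nu(B_r(x))\,d\nu(x)$. For a linear map $L:\mathbb R^d\to\mathbb R^k$ let $$E_q(L)=\frac1{q\log(1/\rho)}\int H_{\rho^q}(L\nu)\,dP(\nu),\qquad E(L)=\lim_{q\to\infty}E_q(L).$$ **Theorem.** Let $P$ be the distribution of an ergodic CP-chain for a $\rho$-regular partition operator, $0<\rho<1$. Then the limit $E(L)$ exists for every surjective linear map $L:\mathbb R^d\to\mathbb R^k$, and for $P$-a.e. measure $\mu$ the following holds. For every $C^1$ map $g:\operatorname{supp}\mu\to\mathbb R^k$ without singular points (that is, $g$ is $C^1$ on an open neighbourhood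 of $\operatorname{supp}\mu$ and $D_xg$ is surjective for every $x\in\operatorname{supp}\mu$), $$\dim_*g\mu\ \ge\ \operatorname*{ess\,inf}_{x\sim\mu}E(D_xg).$$ -/

import Mathlib

open MeasureTheory ProbabilityTheory Filter Topology
open scoped ENNReal

/-! ### Boxes

`ℝ^d` is `Fin d → ℝ`, which carries the sup norm. -/

/-- A `d`-dimensional box: a product of `d` intervals of positive length, each of them open,
closed or half-open.  `loClosed i` (`hiClosed i`) says whether the lower (upper) end point of the
`i`-th interval belongs to it. -/
@[ext] structure Box (d : ℕ) where
  lo : Fin d → ℝ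
  hi : Fin d → ℝ
  loClosed : Fin d → Bool
  hiClosed : Fin d → Bool
  lo_lt_hi : ∀ i, lo i < hi i

namespace Box

variable {d : ℕ}

/-- The set of points of a box. -/
def toSet (B : Box d) : Set (Fin d → ℝ) :=
  {x | ∀ i, (B.lo i < x i ∨ (B.loClosed i = true ∧ x i = B.lo i)) ∧
    (x i < B.hi i ∨ (B.hiClosed i = true ∧ x i = B.hi i))}

/-- Boxes are measured through their end points and the types of their sides. -/
instance : MeasurableSpace (Box d) :=
  MeasurableSpace.comap (fun B => (B.lo, B.hi, B.loClosed, B.hiClosed)) inferInstance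

/-- The image of a box under `x ↦ a x + b`, where `a > 0`. -/
def homothety (a : ℝ) (ha : 0 < a) (b : Fin d → ℝ) (B : Box d) : Box d where
  lo i := a * B.lo i + b i
  hi i := a * B.hi i + b i
  loClosed := B.loClosed
  hiClosed := B.hiClosed
  lo_lt_hi i := by
    have := mul_lt_mul_of_pos_left (B.lo_lt_hi i) ha
    linarith

/-- The volume of a box. -/
noncomputable def vol (B : Box d) : ℝ := ∏ i, (B.hi i - B.lo i)

theorem vol_pos (B : Box d) : 0 < B.vol :=
  Finset.prod_pos fun i _ => sub_pos.2 (B.lo_lt_hi i)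

/-- The factor by which a box has to be scaled to get volume `1`. -/
noncomputable def scale (B : Box d) : ℝ := B.vol ^ (-(1 / (d : ℝ)))

theorem scale_pos (B : Box d) : 0 < B.scale := Real.rpow_pos_of_pos B.vol_pos _

/-- The homothety `T_B`, which maps `B` to the box `B^*` of volume `1` with lower left corner
at the origin. -/
noncomputable def rescale (B : Box d) (x : Fin d → ℝ) : Fin d → ℝ := B.scale • (x - B.lo)

/-- The normalized box `B^* = T_B B`. -/
noncomputable def normalize (B : Box d) : Box d :=
  B.homothety B.scale B.scale_pos (-(B.scale • B.lo))

end Box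

/-! ### Partition operators -/

/-- A partition operator on a family `family` of boxes: it assigns to each box of the family a
partition of it into boxes of the family, in a translation and scale invariant manner.  (The values
of `part` outside of the family are irrelevant.) -/
structure PartitionOperator (d : ℕ) where
  family : Set (Box d)
  part : Box d → Set (Box d)
  part_subset : ∀ E ∈ family, part E ⊆ family
  pairwise_disjoint : ∀ E ∈ family, (part E).Pairwise fun A B => Disjoint A.toSet B.toSet
  iUnion_eq : ∀ E ∈ family, ⋃ A ∈ part E, A.toSet = E.toSet
  invariant : ∀ (a : ℝ) (ha : 0 < a) (b : Fin d → ℝ), ∀ E ∈ family,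
    E.homothety a ha b ∈ family → part (E.homothety a ha b) = Box.homothety a ha b '' part E

namespace PartitionOperator

variable {d : ℕ}

/-- The iterates `Δ^n B` of a partition operator. -/
def iter (Δ : PartitionOperator d) (B : Box d) : ℕ → Set (Box d)
  | 0 => {B}
  | n + 1 => ⋃ E ∈ Δ.iter B n, Δ.part E

/-- `Δ` is `ρ`-regular: for each box `B` of the family there is a constant `C > 1` such that, for
all `n ≥ 1`, every element of `Δ^n B` contains a closed ball of radius `ρ^n / C` and is contained in
a closed ball of radius `C ρ^n`. -/
def IsRegular (Δ : PartitionOperator d) (ρ : ℝ) : Prop :=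
  ∀ B ∈ Δ.family, ∃ C : ℝ, 1 < C ∧ ∀ n : ℕ, 1 ≤ n → ∀ E ∈ Δ.iter B n,
    (∃ x, Metric.closedBall x (ρ ^ n / C) ⊆ E.toSet) ∧
      (∃ x, E.toSet ⊆ Metric.closedBall x (C * ρ ^ n))

end PartitionOperator

/-! ### CP-chains -/

/-- Pairs `(μ, B)` of a measure and a box.  Measures carry the `σ`-algebra generated by the
evaluations `μ ↦ μ A`, which on probability measures is the Borel `σ`-algebra of the weak
topology. -/
abbrev CPState (d : ℕ) : Type := Measure (Fin d → ℝ) × Box d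

/-- The states of a CP-chain: `B` is in the family on which `Δ` acts (and so is `B^*`, to which the
transition law applies `Δ`), and `μ` is a probability measure supported on `B^*`. -/
def IsCPState {d : ℕ} (Δ : PartitionOperator d) (s : CPState d) : Prop :=
  s.2 ∈ Δ.family ∧ s.2.normalize ∈ Δ.family ∧
    IsProbabilityMeasure s.1 ∧ s.1 s.2.normalize.toSet = 1

/-- `μ^B`: the conditional measure of `μ` on `B`, rescaled by `T_B` to a measure on `B^*`. -/
noncomputable def rescaledMeasure {d : ℕ} (μ : Measure (Fin d → ℝ)) (B : Box d) :
    Measure (Fin d → ℝ) :=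
  (ProbabilityTheory.cond μ B.toSet).map B.rescale

/-- The transition law of a CP-chain: from `(μ, A)` move to `(μ^B, B)`, where `B ∈ Δ (A^*)`, with
probability `μ B`. -/
noncomputable def cpTransition {d : ℕ} (Δ : PartitionOperator d) (s : CPState d) :
    Measure (CPState d) :=
  Measure.sum fun B : Δ.part s.2.normalize =>
    s.1 (B : Box d).toSet • Measure.dirac (rescaledMeasure s.1 (B : Box d), (B : Box d))

/-- The shift on sequences. -/
def seqShift {S : Type*} (ω : ℕ → S) : ℕ → S := fun n => ω (n + 1)

/-- `P` is the law of a Markov process on `S` with transition kernel `κ`: the conditional law of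
the state at time `n + 1` given the states at times `0, …, n` is `κ` of the state at time `n`. -/
def IsMarkovLaw {S : Type*} [MeasurableSpace S] (κ : Kernel S S) (P : Measure (ℕ → S)) : Prop :=
  ∀ n : ℕ,
    P.map (fun ω => ((fun i : Finset.Iic n => ω i), ω (n + 1))) =
      P.map (fun ω => fun i : Finset.Iic n => ω i) ⊗ₘ
        κ.comap (fun h : Finset.Iic n → S => h ⟨n, Finset.mem_Iic.2 le_rfl⟩)
          (measurable_pi_apply _)

/-- `P` is the distribution, on sequences of states, of an ergodic CP-chain for the partition
operator `Δ`: an ergodic stationary Markov process of CP-states with transition law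
`cpTransition Δ`. -/
structure IsErgodicCPChain {d : ℕ} (Δ : PartitionOperator d) (P : Measure (ℕ → CPState d)) :
    Prop where
  isProbabilityMeasure : IsProbabilityMeasure P
  /-- Stationarity (`P` is shift invariant) and ergodicity. -/
  ergodic : Ergodic seqShift P
  ae_state : ∀ᵐ ω ∂P, ∀ n, IsCPState Δ (ω n)
  markov : ∃ κ : Kernel (CPState d) (CPState d), IsMarkovKernel κ ∧
    (∀ᵐ ω ∂P, ∀ n, κ (ω n) = cpTransition Δ (ω n)) ∧ IsMarkovLaw κ P

/-- The distribution of a single measure of the chain. -/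
noncomputable def measureMarginal {d : ℕ} (P : Measure (ℕ → CPState d)) :
    Measure (Measure (Fin d → ℝ)) :=
  P.map fun ω => (ω 0).1

/-! ### Dimension and entropy -/

/-- The lower Hausdorff dimension `inf {dim A : A Borel, ν A > 0}` of a measure. -/
noncomputable def lowerHausdorffDim {X : Type*} [EMetricSpace X] [MeasurableSpace X]
    (ν : Measure X) : ℝ≥0∞ :=
  ⨅ (A : Set X) (_ : MeasurableSet A) (_ : 0 < ν A), dimH A

/-- The `r`-scale entropy `H_r(ν) = -∫ log ν(B_r(x)) dν(x)`, with closed balls. -/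
noncomputable def scaleEntropy {X : Type*} [PseudoMetricSpace X] [MeasurableSpace X]
    (r : ℝ) (ν : Measure X) : ℝ≥0∞ :=
  ∫⁻ x, ENNReal.ofReal (-Real.log (ν.real (Metric.closedBall x r))) ∂ν

/-- `E_q(L)`, the mean over the measures `ν` of the chain of `H_{ρ^q}(L ν) / (q log (1/ρ))`. -/
noncomputable def meanEntropy {d k : ℕ} (P : Measure (ℕ → CPState d)) (ρ : ℝ) (q : ℕ)
    (L : (Fin d → ℝ) →L[ℝ] (Fin k → ℝ)) : ℝ≥0∞ :=
  (∫⁻ ν, scaleEntropy (ρ ^ q) (ν.map L) ∂(measureMarginal P)) /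
    ENNReal.ofReal (q * Real.log (1 / ρ))

/-- The function `E(L) = lim_q E_q(L)` associated to a CP-chain, on linear maps `ℝ^d → ℝ^k`
(an orthogonal projection to a `k`-dimensional subspace is such a map, after a linear
identification of the subspace with `ℝ^k`).  It is written as an upper limit, so that it is defined
without a proof of convergence. -/
noncomputable def cpDim {d k : ℕ} (P : Measure (ℕ → CPState d)) (ρ : ℝ)
    (L : (Fin d → ℝ) →L[ℝ] (Fin k → ℝ)) : ℝ≥0∞ :=
  limsup (fun q : ℕ => meanEntropy P ρ q L) atTop

/-! ### A lower bound in the pointwise ergodic theorem -/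

section Birkhoff

variable {Ω : Type*} {T : Ω → Ω} {f : Ω → ℝ}

/-! The argument is the method of local entropy averages. Started at a typical state `(μ, A)`, the
chain only has to choose a `μ`-random point `x`: it then runs through the magnifications of `μ`
along the cells that contain `x` (`markovLaw_dirac_eq_map_cpPath`). So ergodicity of the chain
becomes a statement about a single `μ`: for `μ`-a.e. `x`, the averages over `n` of the entropies at
scale `ρ^p` of the `L`-images of these magnifications are asymptotically at least their `P`-mean `p
log(1/ρ) E_p(L)`, up to an arbitrarily small loss. Only this lower half of the ergodic theorem is
needed, and only for bounded functions, since the information is truncated.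

Near `x` the map `g` is almost equal to its derivative `L`, so the entropy just mentioned bounds
from below the mean information about `g x` gained between generations `n` and `n + q` of the cells
(`eventually_truncEntropy_le_meanInfoGain`). Here `q = p + c`, where `c` depends on the regularity
constant and on `‖L‖` but not on `p`. Two exponential supermartingale estimates turn these gains
into a bound on mass: the mass of the ball about `g x` times the exponential of the accumulated
gains has integral at most `1`, and the gains differ little from their conditional means. Together,
`ae_forall_eventually_measureReal_closedBall_le` makes `μ (g⁻¹ B_r(g x))` decay with an exponent
close to `(p / q) E_p(L)`. Choosing `p` large with `E_p(L)` near the upper limit reaches every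
exponent below `E(L)`, and the mass distribution principle converts this into a bound for the
dimension.

The exceptional set of measures must not depend on `g`. Therefore the ergodic theorem is applied
only to a countable dense family of linear maps, integer truncation heights and rational bounds, and
each derivative is approximated from that family.

Convergence of `E_q(L)` is a by-product. The power bound for `g = L` already holds with the upper
limit, so `-log ν(L⁻¹ B_{ρ^q}(L x)) / (q log(1/ρ))` has lower limit at least `limsup E_q(L)` almost
everywhere. Fatou's lemma, in `x` and then in `ν`, gives `liminf E_q(L) ≥ limsup E_q(L)`. -/

theorem birkhoffSum_nonneg (h0 : ∀ x, 0 ≤ f x) (n : ℕ) (x : Ω) : 0 ≤ birkhoffSum T f n x :=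
  Finset.sum_nonneg fun _ _ => h0 _

/-- Cut the orbit greedily. A point outside the set costs nothing and is passed in one step; a point
of the set starts a block of length at most `M` whose sum is at most `c` per step. Only a final
stretch of length at most `M` escapes this, and it costs at most `M * B`. -/
theorem birkhoffSum_indicator_le {B c : ℝ} (hc : 0 ≤ c) (h0 : ∀ x, 0 ≤ f x) (hB : ∀ x, f x ≤ B)
    (M : ℕ) (L : ℕ) : ∀ x, birkhoffSum T
      ({x | ∃ n, 1 ≤ n ∧ n ≤ M ∧ birkhoffSum T f n x ≤ c * n}.indicator f) L x ≤ c * L + M * B := by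
  set G := {x | ∃ n, 1 ≤ n ∧ n ≤ M ∧ birkhoffSum T f n x ≤ c * n} with hG
  have hle : ∀ x, G.indicator f x ≤ f x := fun x => Set.indicator_le_self' (fun _ _ => h0 _) x
  have hsum : ∀ n x, birkhoffSum T (G.indicator f) n x ≤ birkhoffSum T f n x := fun n x =>
    Finset.sum_le_sum fun _ _ => hle _
  induction L using Nat.strong_induction_on with
  | _ L ih =>
    intro x
    have hB0 : 0 ≤ B := (h0 x).trans (hB x)
    rcases le_or_gt L M with hLM | hLM
    · have h1 : birkhoffSum T (G.indicator f) L x ≤ L * B := by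
        refine (hsum L x).trans ?_
        have := Finset.sum_le_card_nsmul (Finset.range L) (fun k => f (T^[k] x)) B
          fun _ _ => hB _
        simpa [birkhoffSum] using this
      have h2 : (L : ℝ) * B ≤ M * B := by gcongr
      have : 0 ≤ c * L := by positivity
      linarith
    · by_cases hx : x ∈ G
      · obtain ⟨n, hn1, hnM, hn⟩ := hx
        have hL : L = n + (L - n) := by omega
        have h1 := ih (L - n) (by omega) (T^[n] x)
        rw [hL, birkhoffSum_add]
        have h2 := (hsum n x).trans hn
        push_cast
        linarith
      · have hL : L = 1 + (L - 1) := by omega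
        have h1 := ih (L - 1) (by omega) (T x)
        rw [hL, birkhoffSum_add, birkhoffSum_one, Set.indicator_of_notMem hx,
          Function.iterate_one]
        push_cast
        linarith

variable [MeasurableSpace Ω] {P : Measure Ω}

theorem measurable_birkhoffSum (hT : Measurable T) (hf : Measurable f) (n : ℕ) :
    Measurable (birkhoffSum T f n) := by
  unfold birkhoffSum
  exact Finset.measurable_sum _ fun i _ => hf.comp (hT.iterate i)

/-- Integrate the covering bound over an invariant measure and divide by `L`: the end term `M * B`
disappears as `L → ∞`. Then the sets exhaust the space as `M → ∞`. -/
theorem integral_le_of_ae_exists_birkhoffSum_le [IsProbabilityMeasure P]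
    (hT : MeasurePreserving T P P) (hf : Measurable f) {B c : ℝ} (hc : 0 ≤ c)
    (h0 : ∀ x, 0 ≤ f x) (hB : ∀ x, f x ≤ B)
    (h : ∀ᵐ x ∂P, ∃ n : ℕ, 1 ≤ n ∧ birkhoffSum T f n x ≤ c * n) : ∫ x, f x ∂P ≤ c := by
  have hfi : Integrable f P := Integrable.of_mem_Icc 0 B hf.aemeasurable
    (ae_of_all _ fun x => ⟨h0 x, hB x⟩)
  set G : ℕ → Set Ω := fun M => {x | ∃ n, 1 ≤ n ∧ n ≤ M ∧ birkhoffSum T f n x ≤ c * n} with hG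
  have hGm : ∀ M, MeasurableSet (G M) := by
    intro M
    have : G M = ⋃ n ∈ Finset.Icc 1 M, {x | birkhoffSum T f n x ≤ c * n} := by
      ext x; simp [hG, and_assoc]
    rw [this]
    exact Finset.measurableSet_biUnion _ fun n _ =>
      measurableSet_le (measurable_birkhoffSum hT.measurable hf n) measurable_const
  have hGmono : Monotone G := by
    rintro M N hMN x ⟨n, h1, h2, h3⟩
    exact ⟨n, h1, h2.trans hMN, h3⟩
  have hstep : ∀ M, ∫ x in G M, f x ∂P ≤ c := by
    intro M
    rw [← integral_indicator (hGm M)]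
    set a := ∫ x, (G M).indicator f x ∂P
    have hfM : Integrable ((G M).indicator f) P := hfi.indicator (hGm M)
    have hL : ∀ L : ℕ, L * a ≤ c * L + M * B := by
      intro L
      have h1 : ∫ x, birkhoffSum T ((G M).indicator f) L x ∂P = L * a := by
        unfold birkhoffSum
        rw [integral_finsetSum]
        · have : ∀ i ∈ Finset.range L, ∫ x, (G M).indicator f (T^[i] x) ∂P = a := by
            intro i _
            have hi := hT.iterate i
            rw [← integral_map (f := (G M).indicator f) hi.measurable.aemeasurable
              (by rw [hi.map_eq]; exact hfM.aestronglyMeasurable), hi.map_eq]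
          rw [Finset.sum_congr rfl this]
          simp
        · intro i _
          exact ((hT.iterate i).integrable_comp hfM.aestronglyMeasurable).2 hfM
      rw [← h1]
      have h2 : ∫ _x : Ω, (c * L + M * B) ∂P = c * L + M * B := by simp
      rw [← h2]
      refine integral_mono_of_nonneg (ae_of_all _ fun x => ?_) (integrable_const _)
        (ae_of_all _ (birkhoffSum_indicator_le hc h0 hB M L))
      exact birkhoffSum_nonneg (fun x => Set.indicator_nonneg (fun _ _ => h0 _) x) _ _
    by_contra! hac
    obtain ⟨L, hL'⟩ := exists_nat_gt (M * B / (a - c))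
    rw [div_lt_iff₀ (sub_pos.2 hac)] at hL'
    have := hL L
    linarith
  have hlim := tendsto_setIntegral_of_monotone hGm hGmono hfi.integrableOn
  have huniv : (⋃ M, G M) =ᵐ[P] Set.univ := by
    rw [eventuallyEq_univ]
    filter_upwards [h] with x ⟨n, h1, h2⟩
    exact Set.mem_iUnion.2 ⟨n, n, h1, le_rfl, h2⟩
  rw [setIntegral_congr_set huniv, setIntegral_univ] at hlim
  exact le_of_tendsto' hlim hstep

/-- The lower half of the pointwise ergodic theorem, for bounded nonnegative functions. -/
theorem Ergodic.ae_eventually_le_birkhoffSum [IsProbabilityMeasure P]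
    (hT : Ergodic T P) (hf : Measurable f) {B c : ℝ}
    (h0 : ∀ x, 0 ≤ f x) (hB : ∀ x, f x ≤ B) (hc : c < ∫ x, f x ∂P) :
    ∀ᵐ x ∂P, ∀ᶠ n : ℕ in atTop, c * n ≤ birkhoffSum T f n x := by
  rcases lt_or_ge c 0 with hc0 | hc0
  · refine ae_of_all _ fun x => Eventually.of_forall fun n => ?_
    have h1 := birkhoffSum_nonneg (T := T) h0 n x
    have : c * n ≤ 0 := mul_nonpos_of_nonpos_of_nonneg hc0.le (Nat.cast_nonneg _)
    linarith
  -- The free constant `K` absorbs the shift of `n` by one, so that the set is carried into itself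
  -- by `T` and the zero-one law applies.
  set Bad : Set Ω := {x | ∃ K : ℕ, ∀ m : ℕ, ∃ n : ℕ, m ≤ n ∧ birkhoffSum T f n x < c * n + K}
    with hBad
  have hmeas : MeasurableSet Bad := by
    have : Bad = ⋃ K : ℕ, ⋂ m : ℕ, ⋃ n : ℕ, ⋃ _ : m ≤ n,
        {x | birkhoffSum T f n x < c * n + K} := by
      ext x; simp [hBad]
    rw [this]
    exact .iUnion fun K => .iInter fun m => .iUnion fun n => .iUnion fun _ =>
      measurableSet_lt (measurable_birkhoffSum hT.measurable hf n) measurable_const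
  have hinv : Bad ⊆ T ⁻¹' Bad := by
    rintro x ⟨K, hK⟩
    refine ⟨K + ⌈c⌉₊, fun m => ?_⟩
    obtain ⟨n, hmn, hn⟩ := hK (m + 1)
    refine ⟨n - 1, by omega, ?_⟩
    have hn' : n = 1 + (n - 1) := by omega
    have h1 := birkhoffSum_add T f 1 (n - 1) x
    rw [← hn', birkhoffSum_one, Function.iterate_one] at h1
    have h2 := h0 x
    have h3 : (n : ℝ) = 1 + ((n - 1 : ℕ) : ℝ) := by exact_mod_cast hn'
    have h4 := Nat.le_ceil c
    push_cast
    rw [h3] at hn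
    linarith
  rcases hT.ae_empty_or_univ_of_ae_le_preimage hmeas.nullMeasurableSet
    (LE.le.eventuallyLE hinv) with h | h
  · have h' : ∀ᵐ x ∂P, x ∉ Bad := by
      filter_upwards [h] with x hx hxB
      have : (∅ : Set Ω) x := by rw [← hx]; exact hxB
      exact this
    filter_upwards [h'] with x hx
    by_contra hne
    refine hx ⟨0, fun m => ?_⟩
    rw [eventually_atTop] at hne
    push Not at hne
    obtain ⟨n, hmn, hn⟩ := hne m
    exact ⟨n, hmn, by simpa using hn⟩
  -- Raising the slope from `c` to `c'` swallows `K` once `n` is large, which bounds the integral by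
  -- `c'`.
  · exfalso
    obtain ⟨c', hcc', hc'⟩ := exists_between hc
    refine hc'.not_ge (integral_le_of_ae_exists_birkhoffSum_le hT.toMeasurePreserving hf
      (hc0.trans hcc'.le) h0 hB ?_)
    rw [eventuallyEq_univ] at h
    filter_upwards [h] with x ⟨K, hK⟩
    obtain ⟨m, hm⟩ := exists_nat_gt (K / (c' - c))
    obtain ⟨n, hmn, hn⟩ := hK (m + 1)
    refine ⟨n, by omega, hn.le.trans ?_⟩
    rw [div_lt_iff₀ (sub_pos.2 hcc')] at hm
    have : (m : ℝ) ≤ n := by exact_mod_cast (by omega : m ≤ n)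
    nlinarith

end Birkhoff

/-! ### The mass distribution principle -/

/-- Some set of points sharing one constant `C` has positive mass. On it `ν` is at most `C` times
the `β`-dimensional Hausdorff measure, which therefore cannot vanish on `A`. -/
theorem le_lowerHausdorffDim_of_ae_measure_closedBall_le {X : Type*} [MetricSpace X]
    [MeasurableSpace X] [BorelSpace X] {ν : Measure X} {β : NNReal}
    (h : ∀ᵐ y ∂ν, ∃ C : ℕ, ∀ r : ℝ, 0 ≤ r →
      ν (Metric.closedBall y r) ≤ C * ENNReal.ofReal r ^ (β : ℝ)) :
    (β : ℝ≥0∞) ≤ lowerHausdorffDim ν := by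
  refine le_iInf fun A => le_iInf fun _ => le_iInf fun hνA => ?_
  set S : ℕ → Set X := fun C => {y | y ∈ A ∧ ∀ r : ℝ, 0 ≤ r →
      ν (Metric.closedBall y r) ≤ C * ENNReal.ofReal r ^ (β : ℝ)}
  have hcov : A ≤ᵐ[ν] ⋃ C, S C := by
    filter_upwards [h] with y ⟨C, hC⟩ hyA
    exact Set.mem_iUnion.2 ⟨C, hyA, hC⟩
  have hpos : 0 < ν (⋃ C, S C) := hνA.trans_le (measure_mono_ae hcov)
  obtain ⟨C, hC⟩ := (measure_iUnion_null_iff.not.1 hpos.ne') |> not_forall.1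
  refine le_dimH_of_hausdorffMeasure_ne_zero fun h0 => hC ?_
  have hle : ν.restrict (S C) ≤ (C : ℝ≥0∞) • μH[(β : ℝ)] := by
    -- For `C = 0` all balls about a single point are null, hence so is the whole space.
    rcases Nat.eq_zero_or_pos C with rfl | hCpos
    · have : ν (S 0) = 0 := by
        by_contra hne
        obtain ⟨y, hy⟩ := nonempty_of_measure_ne_zero hne
        refine hne (measure_mono_null ?_ ((measure_iUnion_null_iff (s := fun n : ℕ =>
          Metric.closedBall y n)).2 fun n => ?_))
        · intro z _
          obtain ⟨n, hn⟩ := exists_nat_ge (dist z y)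
          exact Set.mem_iUnion.2 ⟨n, hn⟩
        · simpa using hy.2 n n.cast_nonneg
      rw [Measure.restrict_eq_zero.2 this]
      exact bot_le
    have hC0 : (C : ℝ≥0∞) ≠ 0 := by exact_mod_cast hCpos.ne'
    have hCt : (C : ℝ≥0∞) ≠ ∞ := ENNReal.natCast_ne_top C
    have : (C : ℝ≥0∞)⁻¹ • ν.restrict (S C) ≤ μH[(β : ℝ)] := by
      refine Measure.le_hausdorffMeasure _ _ 1 one_pos fun s hs => ?_
      rw [Measure.smul_apply, smul_eq_mul, mul_comm, ← div_eq_mul_inv]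
      refine ENNReal.div_le_of_le_mul ?_
      -- `S C` need not be measurable, so the restriction is evaluated on the closure of `s`, which
      -- is measurable and has the same diameter.
      refine (measure_mono subset_closure).trans ?_
      rw [Measure.restrict_apply isClosed_closure.measurableSet]
      rcases (closure s ∩ S C).eq_empty_or_nonempty with he | ⟨y, hys, hyS⟩
      · simp [he]
      have hst : Metric.ediam s ≠ ∞ := (hs.trans_lt ENNReal.one_lt_top).ne
      have hsub : closure s ∩ S C ⊆ Metric.closedBall y (Metric.ediam s).toReal := by
        rintro z ⟨hz, -⟩
        rw [Metric.mem_closedBall, dist_edist]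
        refine ENNReal.toReal_mono hst ?_
        rw [← Metric.ediam_closure]
        exact Metric.edist_le_ediam_of_mem hz hys
      refine (measure_mono hsub).trans ((hyS.2 _ ENNReal.toReal_nonneg).trans ?_)
      rw [ENNReal.ofReal_toReal hst, mul_comm]
    calc ν.restrict (S C) = (C : ℝ≥0∞) • ((C : ℝ≥0∞)⁻¹ • ν.restrict (S C)) := by
          rw [smul_smul, ENNReal.mul_inv_cancel hC0 hCt, one_smul]
      _ ≤ _ := by gcongr
  have h1 : ν (S C) ≤ ν.restrict (S C) A := by
    have hsub : S C ⊆ A ∩ S C := fun y hy => ⟨hy.1, hy⟩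
    exact (measure_mono hsub).trans (Measure.le_restrict_apply _ _)
  have h2 := h1.trans (hle A)
  simpa [h0] using h2

/-! ### Boxes and homotheties -/

namespace Box

variable {d : ℕ}

theorem measurable_coords :
    Measurable fun B : Box d => (B.lo, B.hi, B.loClosed, B.hiClosed) :=
  comap_measurable _

instance : Nonempty (Box d) :=
  ⟨⟨0, 1, fun _ => true, fun _ => true, fun _ => by simp⟩⟩

/-- This allows the law of the pair `(μ, A)` to be disintegrated over `μ`. -/
instance : StandardBorelSpace (Box d) := by
  set S : Set ((Fin d → ℝ) × (Fin d → ℝ) × (Fin d → Bool) × (Fin d → Bool)) :=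
    {p | ∀ i, p.1 i < p.2.1 i} with hS
  have hSm : MeasurableSet S := by
    have : S = ⋂ i, {p | p.1 i < p.2.1 i} := by ext; simp [hS]
    rw [this]
    exact .iInter fun i => measurableSet_lt (by fun_prop) (by fun_prop)
  have : StandardBorelSpace S := hSm.standardBorel
  let e : Box d ≃ᵐ S :=
    { toFun := fun B => ⟨(B.lo, B.hi, B.loClosed, B.hiClosed), B.lo_lt_hi⟩
      invFun := fun p => ⟨p.1.1, p.1.2.1, p.1.2.2.1, p.1.2.2.2, p.2⟩
      left_inv := fun _ => rfl
      right_inv := fun _ => rfl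
      measurable_toFun := measurable_coords.subtype_mk
      measurable_invFun := by
        refine measurable_comap_iff.2 ?_
        exact measurable_subtype_coe }
  obtain ⟨τ, hτb, hτp⟩ := this.polish
  let t : TopologicalSpace (Box d) := τ.induced e
  have he : Topology.IsInducing e := ⟨rfl⟩
  refine ⟨t, ⟨?_⟩, (e.toEquiv.toHomeomorphOfIsInducing he).isClosedEmbedding.polishSpace⟩
  have h : @borel (Box d) (τ.induced e) = (@borel S τ).comap e := borel_comap
  refine Eq.trans ?_ h.symm
  refine e.measurableEmbedding.comap_eq.symm.trans ?_
  exact congrArg (MeasurableSpace.comap e) hτb.measurable_eq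

theorem measurableSet_toSet (B : Box d) : MeasurableSet B.toSet := by
  have : B.toSet = ⋂ i, {x : Fin d → ℝ | (B.lo i < x i ∨ (B.loClosed i = true ∧ x i = B.lo i)) ∧
      (x i < B.hi i ∨ (B.hiClosed i = true ∧ x i = B.hi i))} := by
    ext; simp [toSet]
  rw [this]
  refine .iInter fun i => .inter (.union ?_ (.inter ?_ ?_)) (.union ?_ (.inter ?_ ?_))
  · exact measurableSet_lt measurable_const (measurable_pi_apply i)
  · exact .const _
  · exact measurableSet_eq_fun (measurable_pi_apply i) measurable_const
  · exact measurableSet_lt (measurable_pi_apply i) measurable_const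
  · exact .const _
  · exact measurableSet_eq_fun (measurable_pi_apply i) measurable_const

theorem le_of_mem {B : Box d} {x : Fin d → ℝ} (hx : x ∈ B.toSet) (i : Fin d) :
    B.lo i ≤ x i ∧ x i ≤ B.hi i :=
  ⟨(hx i).1.elim le_of_lt fun h => h.2.ge, (hx i).2.elim le_of_lt fun h => h.2.le⟩

theorem nonempty_interior (B : Box d) : (interior B.toSet).Nonempty := by
  have hopen : IsOpen (Set.univ.pi fun i => Set.Ioo (B.lo i) (B.hi i)) :=
    isOpen_set_pi Set.finite_univ fun _ _ => isOpen_Ioo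
  refine ⟨fun i => (B.lo i + B.hi i) / 2,
    interior_maximal (fun x hx i => ?_) hopen fun i _ => ?_⟩
  · exact ⟨.inl (hx i trivial).1, .inl (hx i trivial).2⟩
  · have := B.lo_lt_hi i
    constructor <;> linarith

@[simp] theorem homothety_mem_toSet (a : ℝ) (ha : 0 < a) (b : Fin d → ℝ) (B : Box d)
    (x : Fin d → ℝ) : (fun i => a * x i + b i) ∈ (B.homothety a ha b).toSet ↔ x ∈ B.toSet := by
  simp [toSet, homothety, ha, ha.ne']

theorem homothety_injective (a : ℝ) (ha : 0 < a) (b : Fin d → ℝ) :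
    Function.Injective (homothety a ha b) := by
  intro B C h
  have h1 := congrArg lo h
  have h2 := congrArg hi h
  have h3 := congrArg loClosed h
  have h4 := congrArg hiClosed h
  ext i
  · simpa [homothety, ha.ne'] using congrFun h1 i
  · simpa [homothety, ha.ne'] using congrFun h2 i
  · exact congrFun h3 i
  · exact congrFun h4 i

theorem vol_homothety (a : ℝ) (ha : 0 < a) (b : Fin d → ℝ) (B : Box d) :
    (B.homothety a ha b).vol = a ^ d * B.vol := by
  simp only [vol, homothety]
  have : a ^ d = ∏ _i : Fin d, a := by simp
  rw [this, ← Finset.prod_mul_distrib]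
  exact Finset.prod_congr rfl fun i _ => by ring

theorem scale_zero (B : Box 0) : B.scale = 1 := by simp [scale, vol]

theorem scale_homothety (hd : d ≠ 0) (a : ℝ) (ha : 0 < a) (b : Fin d → ℝ) (B : Box d) :
    (B.homothety a ha b).scale = a⁻¹ * B.scale := by
  rw [scale, vol_homothety, Real.mul_rpow (by positivity) B.vol_pos.le, ← Real.rpow_natCast,
    ← Real.rpow_mul ha.le, scale]
  congr 1
  rw [mul_neg, mul_one_div_cancel (by exact_mod_cast hd), Real.rpow_neg_one]

/-- The image of the box `E` under the homothety `T_D`. -/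
noncomputable def relative (D E : Box d) : Box d :=
  E.homothety D.scale D.scale_pos (-(D.scale • D.lo))

theorem rescale_eq (D : Box d) (x : Fin d → ℝ) :
    D.rescale x = fun i => D.scale * x i + (-(D.scale • D.lo)) i := by
  ext i
  simp [rescale]
  ring

@[simp] theorem rescale_mem_relative (D E : Box d) (x : Fin d → ℝ) :
    D.rescale x ∈ (relative D E).toSet ↔ x ∈ E.toSet := by
  rw [rescale_eq, relative, homothety_mem_toSet]

theorem relative_self (D : Box d) : relative D D = D.normalize := rfl

theorem scale_relative_mul (D E : Box d) : (relative D E).scale * D.scale = E.scale := by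
  -- In dimension zero all volumes and scales are `1`, and the scaling law for homotheties fails.
  rcases eq_or_ne d 0 with rfl | hd
  · simp [scale_zero]
  · rw [relative, scale_homothety hd]
    field_simp [D.scale_pos.ne']

theorem scale_normalize (D : Box d) : D.normalize.scale = 1 := by
  have := scale_relative_mul D D
  rw [relative_self] at this
  exact mul_right_cancel₀ D.scale_pos.ne' (this.trans (one_mul _).symm)

theorem rescale_relative (D E : Box d) (x : Fin d → ℝ) :
    (relative D E).rescale (D.rescale x) = E.rescale x := by
  ext i
  rw [rescale, rescale, rescale, ← scale_relative_mul D E]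
  simp [relative, homothety]
  ring

theorem normalize_relative (D E : Box d) : (relative D E).normalize = E.normalize := by
  have h := scale_relative_mul D E
  ext i
  · simp [normalize, homothety]
  · have : (relative D E).hi i - (relative D E).lo i = D.scale * (E.hi i - E.lo i) := by
      simp [relative, homothety]; ring
    have h2 : (relative D E).normalize.hi i =
        (relative D E).scale * ((relative D E).hi i - (relative D E).lo i) := by
      simp [normalize, homothety]; ring
    have h3 : E.normalize.hi i = E.scale * (E.hi i - E.lo i) := by
      simp [normalize, homothety]; ring
    rw [h2, h3, this, ← mul_assoc, h]
  · rfl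
  · rfl

theorem normalize_normalize (D : Box d) : D.normalize.normalize = D.normalize :=
  normalize_relative D D

theorem rescale_normalize (D : Box d) : D.normalize.rescale = id := by
  ext x i
  have : D.normalize.lo = 0 := by
    ext j; simp [normalize, homothety]
  simp [rescale, scale_normalize, this]

theorem continuous_rescale (B : Box d) : Continuous B.rescale := by
  unfold rescale
  fun_prop

theorem measurable_rescale (B : Box d) : Measurable B.rescale := B.continuous_rescale.measurable

theorem scale_le_of_closedBall_subset {B : Box d} {x : Fin d → ℝ} {r : ℝ} (hr : 0 < r)
    (hr1 : r ≤ 1) (h : Metric.closedBall x r ⊆ B.toSet) : B.scale ≤ r⁻¹ := by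
  rcases eq_or_ne d 0 with rfl | hd
  · rw [scale_zero]
    exact (one_le_inv₀ hr).2 hr1
  have hside : ∀ i, r ≤ B.hi i - B.lo i := by
    intro i
    have h1 : (fun j => x j + r) ∈ B.toSet := h (by
      rw [Metric.mem_closedBall, dist_pi_le_iff hr.le]
      intro j; simp [abs_of_pos hr])
    have h2 : x ∈ B.toSet := h (Metric.mem_closedBall_self hr.le)
    have := le_of_mem h1 i
    have := le_of_mem h2 i
    linarith
  have hvol : r ^ d ≤ B.vol := by
    have := Finset.prod_le_prod (s := Finset.univ) (f := fun _ : Fin d => r)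
      (fun _ _ => hr.le) fun i _ => hside i
    simpa [vol] using this
  rw [scale, Real.rpow_neg B.vol_pos.le]
  refine inv_anti₀ hr ?_
  calc r = (r ^ d) ^ (1 / (d : ℝ)) := by
        rw [← Real.rpow_natCast, ← Real.rpow_mul hr.le, mul_one_div_cancel (by exact_mod_cast hd),
          Real.rpow_one]
    _ ≤ _ := Real.rpow_le_rpow (by positivity) hvol (by positivity)

end Box

/-! ### The cells of the iterated partitions -/

namespace PartitionOperator

variable {d : ℕ} (Δ : PartitionOperator d)

/-- Boxes have nonempty interior, and a separable space has room for only countably many disjoint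
ones. -/
theorem countable_part {E : Box d} (hE : E ∈ Δ.family) : (Δ.part E).Countable :=
  (show (Δ.part E).PairwiseDisjoint Box.toSet from
    Δ.pairwise_disjoint E hE).countable_of_nonempty_interior fun B _ => B.nonempty_interior

theorem eq_of_mem_part {E B C : Box d} (hE : E ∈ Δ.family) (hB : B ∈ Δ.part E)
    (hC : C ∈ Δ.part E) {x : Fin d → ℝ} (hxB : x ∈ B.toSet) (hxC : x ∈ C.toSet) : B = C := by
  by_contra hne
  exact Set.disjoint_left.1 (Δ.pairwise_disjoint E hE hB hC hne) hxB hxC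

theorem part_normalize {D : Box d} (hD : D ∈ Δ.family) (hD' : D.normalize ∈ Δ.family) :
    Δ.part D.normalize = Box.relative D '' Δ.part D :=
  Δ.invariant _ _ _ D hD hD'

open Classical in
/-- The element of the partition of `E` which contains `x` (and `E`, if there is none). -/
noncomputable def child (E : Box d) (x : Fin d → ℝ) : Box d :=
  if h : ∃ F ∈ Δ.part E, x ∈ F.toSet then h.choose else E

variable {Δ}

theorem child_spec {E : Box d} (hE : E ∈ Δ.family) {x : Fin d → ℝ} (hx : x ∈ E.toSet) :
    Δ.child E x ∈ Δ.part E ∧ x ∈ (Δ.child E x).toSet := by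
  have h : ∃ F ∈ Δ.part E, x ∈ F.toSet := by
    rw [← Δ.iUnion_eq E hE] at hx
    simpa using hx
  rw [child, dif_pos h]
  exact h.choose_spec

theorem child_of_notMem {E : Box d} (hE : E ∈ Δ.family) {x : Fin d → ℝ} (hx : x ∉ E.toSet) :
    Δ.child E x = E := by
  rw [child, dif_neg]
  rintro ⟨F, hF, hxF⟩
  rw [← Δ.iUnion_eq E hE] at hx
  exact hx (Set.mem_biUnion hF hxF)

theorem child_eq {E F : Box d} (hE : E ∈ Δ.family) (hF : F ∈ Δ.part E) {x : Fin d → ℝ}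
    (hx : x ∈ F.toSet) : Δ.child E x = F := by
  have hxE : x ∈ E.toSet := by
    rw [← Δ.iUnion_eq E hE]; exact Set.mem_biUnion hF hx
  exact Δ.eq_of_mem_part hE (child_spec hE hxE).1 hF (child_spec hE hxE).2 hx

theorem child_mem_family {E : Box d} (hE : E ∈ Δ.family) (x : Fin d → ℝ) :
    Δ.child E x ∈ Δ.family := by
  by_cases hx : x ∈ E.toSet
  · exact Δ.part_subset E hE (child_spec hE hx).1
  · rwa [child_of_notMem hE hx]

theorem range_child_countable {E : Box d} (hE : E ∈ Δ.family) :
    (Set.range (Δ.child E)).Countable := by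
  refine ((Δ.countable_part hE).insert E).mono ?_
  rintro _ ⟨x, rfl⟩
  by_cases hx : x ∈ E.toSet
  · exact .inr (child_spec hE hx).1
  · exact .inl (child_of_notMem hE hx)

theorem measurableSet_child_preimage {E : Box d} (hE : E ∈ Δ.family) (F : Box d) :
    MeasurableSet (Δ.child E ⁻¹' {F}) := by
  have : Δ.child E ⁻¹' {F} = {x | F ∈ Δ.part E ∧ x ∈ F.toSet} ∪ {x | F = E ∧ x ∈ E.toSetᶜ} := by
    ext x
    simp only [Set.mem_preimage, Set.mem_singleton_iff, Set.mem_union, Set.mem_ofPred_eq,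
      Set.mem_compl_iff]
    constructor
    · rintro rfl
      by_cases hx : x ∈ E.toSet
      · exact .inl (child_spec hE hx)
      · exact .inr ⟨child_of_notMem hE hx, hx⟩
    · rintro (⟨h1, h2⟩ | ⟨rfl, h2⟩)
      · exact child_eq hE h1 h2
      · exact child_of_notMem hE h2
  rw [this]
  exact .union (.inter (.const _) F.measurableSet_toSet)
    (.inter (.const _) E.measurableSet_toSet.compl)

variable (Δ)

/-- The element of the `n`-th iterated partition of `A` which contains `x`. -/
noncomputable def cell (A : Box d) : ℕ → (Fin d → ℝ) → Box d
  | 0, _ => A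
  | n + 1, x => Δ.child (cell A n x) x

variable {Δ} {A : Box d}

theorem cell_mem_family (hA : A ∈ Δ.family) (n : ℕ) (x : Fin d → ℝ) : Δ.cell A n x ∈ Δ.family := by
  induction n with
  | zero => exact hA
  | succ n ih => exact child_mem_family ih x

theorem mem_cell (hA : A ∈ Δ.family) {x : Fin d → ℝ} (hx : x ∈ A.toSet) (n : ℕ) :
    x ∈ (Δ.cell A n x).toSet := by
  induction n with
  | zero => exact hx
  | succ n ih => exact (child_spec (cell_mem_family hA n x) ih).2

theorem cell_succ_mem_part (hA : A ∈ Δ.family) {x : Fin d → ℝ} (hx : x ∈ A.toSet) (n : ℕ) :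
    Δ.cell A (n + 1) x ∈ Δ.part (Δ.cell A n x) :=
  (child_spec (cell_mem_family hA n x) (mem_cell hA hx n)).1

theorem cell_mem_iter (hA : A ∈ Δ.family) {x : Fin d → ℝ} (hx : x ∈ A.toSet) (n : ℕ) :
    Δ.cell A n x ∈ Δ.iter A n := by
  induction n with
  | zero => rfl
  | succ n ih => exact Set.mem_biUnion ih (cell_succ_mem_part hA hx n)

theorem toSet_subset_of_mem_part {E F : Box d} (hE : E ∈ Δ.family) (hF : F ∈ Δ.part E) :
    F.toSet ⊆ E.toSet := by
  rw [← Δ.iUnion_eq E hE]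
  exact Set.subset_biUnion_of_mem (u := fun A : Box d => A.toSet) hF

theorem cell_succ_subset (hA : A ∈ Δ.family) {x : Fin d → ℝ} (hx : x ∈ A.toSet) (n : ℕ) :
    (Δ.cell A (n + 1) x).toSet ⊆ (Δ.cell A n x).toSet :=
  toSet_subset_of_mem_part (cell_mem_family hA n x) (cell_succ_mem_part hA hx n)

theorem cell_subset (hA : A ∈ Δ.family) {x : Fin d → ℝ} (hx : x ∈ A.toSet) (n : ℕ) :
    (Δ.cell A n x).toSet ⊆ A.toSet := by
  induction n with
  | zero => exact subset_rfl
  | succ n ih => exact (cell_succ_subset hA hx n).trans ih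

theorem cell_eq_of_mem (hA : A ∈ Δ.family) {x y : Fin d → ℝ} (hx : x ∈ A.toSet) (n : ℕ)
    (hy : y ∈ (Δ.cell A n x).toSet) : Δ.cell A n y = Δ.cell A n x := by
  induction n with
  | zero => rfl
  | succ n ih =>
    have h1 := ih (cell_succ_subset hA hx n hy)
    rw [cell, h1]
    exact child_eq (cell_mem_family hA n x) (cell_succ_mem_part hA hx n) hy

theorem preimage_cell_inter (hA : A ∈ Δ.family) {x : Fin d → ℝ} (hx : x ∈ A.toSet) (n : ℕ) :
    Δ.cell A n ⁻¹' {Δ.cell A n x} ∩ A.toSet = (Δ.cell A n x).toSet := by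
  ext y
  constructor
  · rintro ⟨h1, h2⟩
    have := mem_cell (Δ := Δ) hA h2 n
    rw [Set.mem_preimage, Set.mem_singleton_iff] at h1
    rwa [h1] at this
  · intro hy
    exact ⟨cell_eq_of_mem hA hx n hy, cell_subset hA hx n hy⟩

theorem cell_eq_of_cell_succ_eq (hA : A ∈ Δ.family) {x y : Fin d → ℝ} (n : ℕ) (hx : x ∈ A.toSet)
    (hy : y ∈ A.toSet)
    (h : Δ.cell A (n + 1) x = Δ.cell A (n + 1) y) : Δ.cell A n x = Δ.cell A n y := by
  have h1 := mem_cell (Δ := Δ) hA hx (n + 1)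
  rw [h] at h1
  exact cell_eq_of_mem hA hy n (cell_succ_subset hA hy n h1)

theorem range_cell_countable (hA : A ∈ Δ.family) (n : ℕ) : (Set.range (Δ.cell A n)).Countable := by
  induction n with
  | zero => exact (Set.countable_singleton A).mono (by rintro _ ⟨x, rfl⟩; rfl)
  | succ n ih =>
    refine (ih.biUnion (t := fun E _ => ⋃ _ : E ∈ Δ.family, Set.range (Δ.child E))
      fun E _ => ?_).mono ?_
    · by_cases hE : E ∈ Δ.family
      · simpa [hE] using range_child_countable hE
      · simp [hE]
    · rintro _ ⟨x, rfl⟩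
      refine Set.mem_biUnion ⟨x, rfl⟩ (Set.mem_iUnion.2 ⟨cell_mem_family hA n x, x, rfl⟩)

theorem measurableSet_cell_preimage (hA : A ∈ Δ.family) (n : ℕ) (F : Box d) :
    MeasurableSet (Δ.cell A n ⁻¹' {F}) := by
  induction n generalizing F with
  | zero => exact .const (A ∈ ({F} : Set (Box d)))
  | succ n ih =>
    have : Δ.cell A (n + 1) ⁻¹' {F} = ⋃ E ∈ Set.range (Δ.cell A n),
        Δ.cell A n ⁻¹' {E} ∩ Δ.child E ⁻¹' {F} := by
      ext x
      simp only [Set.mem_preimage, Set.mem_singleton_iff, cell, Set.mem_iUnion, Set.mem_inter_iff,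
        exists_prop]
      exact ⟨fun h => ⟨_, ⟨x, rfl⟩, rfl, h⟩, fun ⟨_, _, h, h'⟩ => h ▸ h'⟩
    rw [this]
    refine .biUnion (range_cell_countable hA n) fun E hE => (ih E).inter ?_
    obtain ⟨x, rfl⟩ := hE
    exact measurableSet_child_preimage (cell_mem_family hA n x) F

end PartitionOperator

/-! ### Countable partitions -/

section Partition

variable {X β : Type*} [MeasurableSpace X]

/-- The fibres of `c` form a countable partition into measurable sets. -/
structure IsCountablePartition (c : X → β) : Prop where
  countable_range : (Set.range c).Countable
  measurableSet_preimage : ∀ b, MeasurableSet (c ⁻¹' {b})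

namespace IsCountablePartition

variable {c : X → β} (hc : IsCountablePartition c) {μ : Measure X}
include hc

theorem measurableSet_of_saturated {S : Set X} (h : ∀ x y, c x = c y → x ∈ S → y ∈ S) :
    MeasurableSet S := by
  have : S = ⋃ b ∈ c '' S, c ⁻¹' {b} := by
    ext y
    simp only [Set.mem_image, Set.mem_iUnion, Set.mem_preimage, Set.mem_singleton_iff, exists_prop]
    exact ⟨fun hy => ⟨c y, ⟨y, hy, rfl⟩, rfl⟩, fun ⟨_, ⟨x, hx, hxb⟩, hy⟩ => h x y (by rw [hxb, hy]) hx⟩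
  rw [this]
  exact .biUnion (hc.countable_range.mono (Set.image_subset_range _ _))
    fun b _ => hc.measurableSet_preimage b

theorem measurable_of_constant {γ : Type*} [MeasurableSpace γ] {f : X → γ}
    (h : ∀ x y, c x = c y → f x = f y) : Measurable f := fun S _ =>
  hc.measurableSet_of_saturated fun x y hxy hx => by
    rw [Set.mem_preimage] at hx ⊢
    rwa [← h x y hxy]

theorem lintegral_eq_tsum (f : X → ℝ≥0∞) :
    ∫⁻ x, f x ∂μ = ∑' b : Set.range c, ∫⁻ x in c ⁻¹' {(b : β)}, f x ∂μ := by
  have : Countable (Set.range c) := hc.countable_range.to_subtype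
  rw [← lintegral_iUnion (fun b : Set.range c => hc.measurableSet_preimage b)]
  · have : (⋃ b : Set.range c, c ⁻¹' {(b : β)}) = Set.univ := by
      ext x; simp
    rw [this, setLIntegral_univ]
  · intro a b hab
    refine Set.disjoint_left.2 fun x hx hx' => hab (Subtype.ext ?_)
    exact (Set.mem_singleton_iff.1 hx).symm.trans (Set.mem_singleton_iff.1 hx')

/-- One step of a supermartingale, without conditional expectations: on each fibre `ψ` is a constant
and `φ` has mean at most `1`. -/
theorem lintegral_mul_le {ψ φ : X → ℝ≥0∞} (hψ : ∀ x y, c x = c y → ψ x = ψ y)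
    (hφ : ∀ x, ∫⁻ z in c ⁻¹' {c x}, φ z ∂μ ≤ μ (c ⁻¹' {c x})) :
    ∫⁻ x, ψ x * φ x ∂μ ≤ ∫⁻ x, ψ x ∂μ := by
  rw [hc.lintegral_eq_tsum, hc.lintegral_eq_tsum]
  refine ENNReal.tsum_le_tsum ?_
  rintro ⟨_, x, rfl⟩
  have hm := hc.measurableSet_preimage (c x)
  have h1 : ∀ z ∈ c ⁻¹' {c x}, ψ z = ψ x := fun z hz => hψ z x hz
  rw [setLIntegral_congr_fun (g := fun _ => ψ x) hm h1, setLIntegral_const,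
    setLIntegral_congr_fun (g := fun z => ψ x * φ z) hm fun z hz => by simp only [h1 z hz]]
  rcases eq_or_ne (μ (c ⁻¹' {c x})) 0 with h0 | h0
  · rw [Measure.restrict_eq_zero.2 h0]; simp
  rcases eq_or_ne (ψ x) ∞ with ht | ht
  · rw [ht, ENNReal.top_mul h0]; exact le_top
  · rw [lintegral_const_mul' _ _ ht]
    gcongr
    exact hφ x

theorem ae_measure_fiber_ne_zero : ∀ᵐ x ∂μ, μ (c ⁻¹' {c x}) ≠ 0 := by
  rw [ae_iff]
  have : {x | ¬ μ (c ⁻¹' {c x}) ≠ 0} ⊆ ⋃ b ∈ {b ∈ Set.range c | μ (c ⁻¹' {b}) = 0}, c ⁻¹' {b} := by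
    intro x hx
    simp only [ne_eq, not_not] at hx
    exact Set.mem_biUnion (x := c x) ⟨⟨x, rfl⟩, hx⟩ rfl
  refine measure_mono_null this ((measure_biUnion_null_iff
    (hc.countable_range.mono (Set.sep_subset _ _))).2 fun b hb => hb.2)

end IsCountablePartition

end Partition

/-! ### Information and entropy of a map relative to a pair of partitions -/

section Information

variable {X Y β : Type*} [MeasurableSpace X] [PseudoMetricSpace Y]

/-- The union of the fibres of `c'` which lie in the same fibre of `c` as `x`, and whose image under
`g` comes `2 * δ`-close to that of the fibre of `c'` containing `x`. -/
def nearbyFibers (c c' : X → β) (g : X → Y) (δ : ℝ) (x : X) : Set X :=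
  {z | c z = c x ∧ ∃ u v, c' u = c' x ∧ c' v = c' z ∧ dist (g u) (g v) ≤ 2 * δ}

/-- The information, truncated at height `t`, gained on the position of `g x` when passing from the
fibre of `c` to that of `c'`. -/
noncomputable def infoGain (μ : Measure X) (c c' : X → β) (g : X → Y) (δ t : ℝ) (x : X) : ℝ :=
  min (-Real.log (μ.real (nearbyFibers c c' g δ x) / μ.real (c ⁻¹' {c x}))) t

/-- The mean of the information gain over the fibre of `c` which contains `x`. -/
noncomputable def meanInfoGain (μ : Measure X) (c c' : X → β) (g : X → Y) (δ t : ℝ) (x : X) : ℝ :=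
  (∫ z in c ⁻¹' {c x}, infoGain μ c c' g δ t z ∂μ) / μ.real (c ⁻¹' {c x})

variable {μ : Measure X} {c c' : X → β} {g : X → Y} {δ t : ℝ}

theorem infoGain_le (x : X) : infoGain μ c c' g δ t x ≤ t := min_le_right _ _

omit [MeasurableSpace X] in
theorem nearbyFibers_congr (h : ∀ x y, c' x = c' y → c x = c y) {x y : X} (hxy : c' x = c' y) :
    nearbyFibers c c' g δ x = nearbyFibers c c' g δ y := by
  simp only [nearbyFibers, hxy, h x y hxy]

theorem infoGain_congr (h : ∀ x y, c' x = c' y → c x = c y) {x y : X} (hxy : c' x = c' y) :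
    infoGain μ c c' g δ t x = infoGain μ c c' g δ t y := by
  simp only [infoGain, nearbyFibers_congr h hxy, h x y hxy]

theorem meanInfoGain_congr {x y : X} (hxy : c x = c y) :
    meanInfoGain μ c c' g δ t x = meanInfoGain μ c c' g δ t y := by
  simp only [meanInfoGain, hxy]

theorem measurable_infoGain (hc' : IsCountablePartition c') (h : ∀ x y, c' x = c' y → c x = c y) :
    Measurable (infoGain μ c c' g δ t) :=
  hc'.measurable_of_constant fun _ _ => infoGain_congr h

variable [IsProbabilityMeasure μ]

theorem infoGain_nonneg (ht : 0 ≤ t) (x : X) : 0 ≤ infoGain μ c c' g δ t x := by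
  refine le_min (neg_nonneg.2 (Real.log_nonpos (by positivity) ?_)) ht
  exact div_le_one_of_le₀ (measureReal_mono fun z hz => hz.1) measureReal_nonneg

theorem integrable_infoGain (ht : 0 ≤ t) (hc' : IsCountablePartition c')
    (h : ∀ x y, c' x = c' y → c x = c y) : Integrable (infoGain μ c c' g δ t) μ :=
  Integrable.of_mem_Icc 0 t (measurable_infoGain hc' h).aemeasurable
    (ae_of_all _ fun x => ⟨infoGain_nonneg ht x, infoGain_le x⟩)

theorem meanInfoGain_nonneg (ht : 0 ≤ t) (x : X) : 0 ≤ meanInfoGain μ c c' g δ t x :=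
  div_nonneg (integral_nonneg fun z => infoGain_nonneg ht z) measureReal_nonneg

theorem meanInfoGain_le (ht : 0 ≤ t) (hc' : IsCountablePartition c')
    (h : ∀ x y, c' x = c' y → c x = c y) (x : X) : meanInfoGain μ c c' g δ t x ≤ t := by
  refine div_le_of_le_mul₀ measureReal_nonneg ht ?_
  have : ∫ _z in c ⁻¹' {c x}, t ∂μ = t * μ.real (c ⁻¹' {c x}) := by
    simp [mul_comm]
  rw [← this]
  exact integral_mono (integrable_infoGain ht hc' h).integrableOn (integrable_const _)
    fun z => infoGain_le z

/-- If `y` is a point of the image space, the fibres of `c'` close to `y` carry, in each fibre of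
`c`, an integral of `exp` of the information gain which is at most the mass of the fibre. -/
theorem setLIntegral_indicator_exp_infoGain_le (hc : IsCountablePartition c)
    (hc' : IsCountablePartition c') (y : Y) (x : X) :
    ∫⁻ z in c ⁻¹' {c x}, {z | ∃ u, c' u = c' z ∧ dist (g u) y ≤ δ}.indicator
      (fun z => ENNReal.ofReal (Real.exp (infoGain μ c c' g δ t z))) z ∂μ ≤
      μ (c ⁻¹' {c x}) := by
  set V : Set X := {z | ∃ u, c' u = c' z ∧ dist (g u) y ≤ δ} with hV
  have hVm : MeasurableSet V := hc'.measurableSet_of_saturated fun a b hab => by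
    rintro ⟨u, hu, hd⟩
    exact ⟨u, hu.trans hab, hd⟩
  have hm := hc.measurableSet_preimage (c x)
  rw [lintegral_indicator hVm, Measure.restrict_restrict hVm]
  set U := V ∩ c ⁻¹' {c x} with hU
  rcases eq_or_ne (μ U) 0 with h0 | h0
  · rw [Measure.restrict_eq_zero.2 h0]; simp
  have hU0 : 0 < μ.real U := ENNReal.toReal_pos h0 (measure_ne_top _ _)
  have hle : μ.real U ≤ μ.real (c ⁻¹' {c x}) := measureReal_mono Set.inter_subset_right
  have hbound : ∀ z ∈ U, ENNReal.ofReal (Real.exp (infoGain μ c c' g δ t z)) ≤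
      ENNReal.ofReal (μ.real (c ⁻¹' {c x}) / μ.real U) := by
    rintro z ⟨⟨u, hu, hd⟩, hz⟩
    refine ENNReal.ofReal_le_ofReal ?_
    have hz' : c z = c x := hz
    -- Two fibres that both come `δ`-close to `y` are `2 * δ`-close to each other; hence the factor
    -- `2` in `nearbyFibers`. The gain on `U` is thus at most the log of the mass of the whole fibre
    -- over that of `U`.
    have hsub : U ⊆ nearbyFibers c c' g δ z := by
      rintro w ⟨⟨v, hv, hd'⟩, hw⟩
      refine ⟨(show c w = c x from hw).trans hz'.symm, u, v, hu, hv, ?_⟩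
      have := dist_triangle_right (g u) (g v) y
      linarith
    have hN : μ.real U ≤ μ.real (nearbyFibers c c' g δ z) := measureReal_mono hsub
    have hNpos := hU0.trans_le hN
    have hcpos := hU0.trans_le hle
    calc Real.exp (infoGain μ c c' g δ t z)
        ≤ Real.exp (-Real.log (μ.real (nearbyFibers c c' g δ z) / μ.real (c ⁻¹' {c z}))) :=
          Real.exp_le_exp.2 (min_le_left _ _)
      _ = μ.real (c ⁻¹' {c x}) / μ.real (nearbyFibers c c' g δ z) := by
          rw [Real.exp_neg, hz', Real.exp_log (by positivity), inv_div]
      _ ≤ _ := by gcongr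
  calc _ ≤ ∫⁻ z in U, ENNReal.ofReal (μ.real (c ⁻¹' {c x}) / μ.real U) ∂μ :=
        setLIntegral_mono' (hVm.inter hm) hbound
    _ = μ (c ⁻¹' {c x}) := by
        rw [setLIntegral_const, ← ofReal_measureReal (μ := μ) (s := U),
          ← ENNReal.ofReal_mul (by positivity), div_mul_cancel₀ _ hU0.ne', ofReal_measureReal]

/-- For `|u| ≤ 1` one has `exp u ≤ 1 + u + u²`. With `u = s * (mean - gain)` the linear term
integrates to zero over the fibre, and `1 + v ≤ exp v` for `v = (s * t)²` compensates the rest. -/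
theorem setLIntegral_exp_meanInfoGain_sub_le {s : ℝ} (hs : 0 ≤ s) (ht : 0 ≤ t) (hst : s * t ≤ 1)
    (hc : IsCountablePartition c) (hc' : IsCountablePartition c')
    (h : ∀ x y, c' x = c' y → c x = c y) (x : X) :
    ∫⁻ z in c ⁻¹' {c x}, ENNReal.ofReal (Real.exp (s * (meanInfoGain μ c c' g δ t z -
      infoGain μ c c' g δ t z) - (s * t) ^ 2)) ∂μ ≤ μ (c ⁻¹' {c x}) := by
  have hm := hc.measurableSet_preimage (c x)
  rcases eq_or_ne (μ (c ⁻¹' {c x})) 0 with h0 | h0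
  · rw [Measure.restrict_eq_zero.2 h0]; simp
  have hpos : 0 < μ.real (c ⁻¹' {c x}) := ENNReal.toReal_pos h0 (measure_ne_top _ _)
  set m := meanInfoGain μ c c' g δ t x with hmdef
  set I := infoGain μ c c' g δ t
  have hIm : ∫ z in c ⁻¹' {c x}, I z ∂μ = m * μ.real (c ⁻¹' {c x}) := by
    rw [hmdef, meanInfoGain, div_mul_cancel₀ _ hpos.ne']
  have hm0 : 0 ≤ m := meanInfoGain_nonneg ht x
  have hmt : m ≤ t := meanInfoGain_le ht hc' h x
  have hpt : ∀ z ∈ c ⁻¹' {c x}, ENNReal.ofReal (Real.exp (s * (meanInfoGain μ c c' g δ t z - I z) -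
      (s * t) ^ 2)) ≤ ENNReal.ofReal
        (Real.exp (-(s * t) ^ 2) * (1 + s * (m - I z) + (s * t) ^ 2)) := by
    intro z hz
    refine ENNReal.ofReal_le_ofReal ?_
    rw [meanInfoGain_congr (show c z = c x from hz), ← hmdef, sub_eq_add_neg, Real.exp_add,
      mul_comm]
    refine mul_le_mul_of_nonneg_left ?_ (Real.exp_pos _).le
    have hI0 : 0 ≤ I z := infoGain_nonneg ht z
    have hIt : I z ≤ t := infoGain_le z
    have habs : |m - I z| ≤ t := abs_le.2 ⟨by linarith, by linarith⟩
    have habs' : |s * (m - I z)| ≤ s * t := by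
      rw [abs_mul, abs_of_nonneg hs]; gcongr
    have h1 := (abs_le.1 (Real.abs_exp_sub_one_sub_id_le (habs'.trans hst))).2
    have h2 : (s * (m - I z)) ^ 2 ≤ (s * t) ^ 2 := by
      rw [← sq_abs]; gcongr
    linarith
  have hI : Integrable I μ := integrable_infoGain ht hc' h
  have hint : IntegrableOn (fun z => Real.exp (-(s * t) ^ 2) * (1 + s * (m - I z) + (s * t) ^ 2))
      (c ⁻¹' {c x}) μ := by
    refine Integrable.integrableOn ?_
    fun_prop
  have hnn : ∀ z, 0 ≤ Real.exp (-(s * t) ^ 2) * (1 + s * (m - I z) + (s * t) ^ 2) := by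
    intro z
    have hIt : I z ≤ t := infoGain_le z
    have : -(s * t) ≤ s * (m - I z) := by
      rw [← mul_neg]; exact mul_le_mul_of_nonneg_left (by linarith) hs
    have : 0 ≤ 1 + s * (m - I z) + (s * t) ^ 2 := by
      have := sq_nonneg (s * t); linarith
    positivity
  refine (setLIntegral_mono' hm hpt).trans ?_
  rw [← ofReal_integral_eq_lintegral_ofReal hint (ae_of_all _ hnn), ← ofReal_measureReal (μ := μ)]
  refine ENNReal.ofReal_le_ofReal ?_
  have hcalc : ∫ z in c ⁻¹' {c x}, (1 + s * (m - I z) + (s * t) ^ 2) ∂μ =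
      (1 + (s * t) ^ 2) * μ.real (c ⁻¹' {c x}) := by
    have : ∀ z, 1 + s * (m - I z) + (s * t) ^ 2 = (1 + s * m + (s * t) ^ 2) - s * I z := by
      intro z; ring
    simp_rw [this]
    rw [integral_sub (integrable_const _) (hI.integrableOn.const_mul s), integral_const_mul, hIm]
    simp
    ring
  rw [integral_const_mul, hcalc, ← mul_assoc]
  refine mul_le_of_le_one_left hpos.le ?_
  rw [Real.exp_neg, inv_mul_le_iff₀ (Real.exp_pos _), mul_one, add_comm]
  exact Real.add_one_le_exp _

end Information

/-! ### Entropy averages along a nested sequence of partitions -/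

/-- The fibres of the maps `c n` form a refining sequence of countable measurable partitions. -/
structure IsRefining {X β : Type*} [MeasurableSpace X] (c : ℕ → X → β) : Prop where
  isCountablePartition : ∀ n, IsCountablePartition (c n)
  eq_of_eq : ∀ m n, m ≤ n → ∀ x y, c n x = c n y → c m x = c m y

/-- Weighted by the summable sequence `1 / (n + 1)²`, the functions have an integrable sum, so their
weighted values tend to zero almost everywhere. -/
theorem ae_eventually_le_sq_of_lintegral_le_one {X : Type*} [MeasurableSpace X] {μ : Measure X}
    {F : ℕ → X → ℝ≥0∞} (hF : ∀ n, Measurable (F n)) (h : ∀ n, ∫⁻ x, F n x ∂μ ≤ 1) :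
    ∀ᵐ x ∂μ, ∀ᶠ n : ℕ in atTop, F n x ≤ ENNReal.ofReal ((n + 1 : ℝ) ^ 2) := by
  set w : ℕ → ℝ≥0∞ := fun n => ENNReal.ofReal (1 / ((n + 1 : ℕ) : ℝ) ^ 2) with hw
  have hsum : ∑' n, w n ≠ ∞ := by
    refine Summable.tsum_ofReal_ne_top ?_
    exact (summable_nat_add_iff 1).2 (Real.summable_one_div_nat_pow.2 one_lt_two)
  have hlt : ∫⁻ x, ∑' n, w n * F n x ∂μ ≠ ∞ := by
    rw [lintegral_tsum fun n => ((hF n).const_mul _).aemeasurable]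
    refine ne_top_of_le_ne_top hsum (ENNReal.tsum_le_tsum fun n => ?_)
    rw [lintegral_const_mul _ (hF n)]
    exact mul_le_of_le_one_right' (h n)
  have hmeas : Measurable fun x => ∑' n, w n * F n x :=
    Measurable.tsum fun n => (hF n).const_mul _
  filter_upwards [ae_lt_top hmeas hlt] with x hx
  filter_upwards [(ENNReal.tendsto_atTop_zero_of_tsum_ne_top hx.ne).eventually
    (ge_mem_nhds one_pos)] with n hn
  have hpos : (0 : ℝ) < ((n + 1 : ℕ) : ℝ) ^ 2 := by positivity
  have hwn : w n = (ENNReal.ofReal (((n + 1 : ℕ) : ℝ) ^ 2))⁻¹ := by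
    rw [hw]; dsimp only; rw [one_div, ENNReal.ofReal_inv_of_pos hpos]
  rw [hwn, mul_comm, ← div_eq_mul_inv, ENNReal.div_le_iff (ENNReal.ofReal_pos.2 hpos).ne'
    ENNReal.ofReal_ne_top, one_mul] at hn
  simpa using hn

section Averages

variable {X Y β : Type*} [MeasurableSpace X] [PseudoMetricSpace Y] [MeasurableSpace Y]
  [OpensMeasurableSpace Y] [SecondCountableTopology Y] {μ : Measure X} [IsProbabilityMeasure μ]
  {c : ℕ → X → β} {g : X → Y} {δ : ℕ → ℝ} {t : ℝ}

/-- By Fubini the mass of the ball becomes an integral over a second point `y`. For fixed `y` the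
exponential is integrated over fibres whose image meets a ball about `g y`, and refining the
partition by one level does not increase that integral. -/
theorem lintegral_measure_closedBall_mul_exp_sum_infoGain_le (hc : IsRefining c)
    (hg : Measurable g) (hδ : Antitone δ) (J : ℕ) :
    ∫⁻ x, μ (g ⁻¹' Metric.closedBall (g x) (δ J)) * ENNReal.ofReal (Real.exp
      (∑ j ∈ Finset.range J, infoGain μ (c j) (c (j + 1)) g (δ (j + 1)) t x)) ∂μ ≤ 1 := by
  set I : ℕ → X → ℝ := fun j => infoGain μ (c j) (c (j + 1)) g (δ (j + 1)) t with hI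
  have hIm : ∀ j, Measurable (I j) := fun j =>
    measurable_infoGain (hc.isCountablePartition _) (hc.eq_of_eq _ _ j.le_succ)
  have hIc : ∀ j n, j + 1 ≤ n → ∀ x y, c n x = c n y → I j x = I j y := fun j n hjn x y hxy =>
    infoGain_congr (hc.eq_of_eq _ _ j.le_succ) (hc.eq_of_eq _ _ hjn x y hxy)
  have hS : ∀ J x y, c J x = c J y → ∑ j ∈ Finset.range J, I j x = ∑ j ∈ Finset.range J, I j y :=
    fun J x y hxy => Finset.sum_congr rfl fun j hj =>
      hIc j J (Finset.mem_range.1 hj) x y hxy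
  set E : ℕ → X → ℝ≥0∞ := fun J x => ENNReal.ofReal (Real.exp (∑ j ∈ Finset.range J, I j x))
  have hEm : ∀ J, Measurable (E J) := fun J =>
    (Real.measurable_exp.comp (Finset.measurable_sum _ fun j _ => hIm j)).ennreal_ofReal
  -- Since `δ` decreases, a fibre that survives at level `J + 1` lies in one that survives at level
  -- `J`; the extra exponential factor then has mean at most `1` on each fibre of level `J`.
  have key : ∀ (y : Y) (J : ℕ),
      ∫⁻ x, {z | ∃ u, c J u = c J z ∧ dist (g u) y ≤ δ J}.indicator (E J) x ∂μ ≤ 1 := by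
    intro y J
    induction J with
    | zero =>
      calc _ ≤ ∫⁻ _x, 1 ∂μ := lintegral_mono fun x => by
            refine Set.indicator_le_self' (fun _ _ => zero_le) x |>.trans ?_
            simp [E]
        _ = 1 := by simp
    | succ J ih =>
      refine le_trans ?_ ih
      refine le_trans (lintegral_mono fun x => ?_) ((hc.isCountablePartition J).lintegral_mul_le
        (ψ := {z | ∃ u, c J u = c J z ∧ dist (g u) y ≤ δ J}.indicator (E J))
        (φ := {z | ∃ u, c (J + 1) u = c (J + 1) z ∧ dist (g u) y ≤ δ (J + 1)}.indicator
          (fun z => ENNReal.ofReal (Real.exp (I J z)))) ?_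
        fun x => setLIntegral_indicator_exp_infoGain_le (hc.isCountablePartition J)
          (hc.isCountablePartition _) y x)
      · by_cases hx : x ∈ {z | ∃ u, c (J + 1) u = c (J + 1) z ∧ dist (g u) y ≤ δ (J + 1)}
        · have hx' : x ∈ {z | ∃ u, c J u = c J z ∧ dist (g u) y ≤ δ J} := by
            obtain ⟨u, hu, hd⟩ := hx
            exact ⟨u, hc.eq_of_eq _ _ J.le_succ _ _ hu, hd.trans (hδ J.le_succ)⟩
          simp only [Set.indicator_of_mem hx, Set.indicator_of_mem hx', E]
          rw [← ENNReal.ofReal_mul (Real.exp_pos _).le, ← Real.exp_add, Finset.sum_range_succ]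
        · simp only [Set.indicator_of_notMem hx, zero_le]
      · intro a b hab
        by_cases ha : a ∈ {z | ∃ u, c J u = c J z ∧ dist (g u) y ≤ δ J}
        · have hb : b ∈ {z | ∃ u, c J u = c J z ∧ dist (g u) y ≤ δ J} := by
            obtain ⟨u, hu, hd⟩ := ha
            exact ⟨u, hu.trans hab, hd⟩
          rw [Set.indicator_of_mem ha, Set.indicator_of_mem hb]
          simp only [E, hS J a b hab]
        · have hb : b ∉ {z | ∃ u, c J u = c J z ∧ dist (g u) y ≤ δ J} := by
            rintro ⟨u, hu, hd⟩
            exact ha ⟨u, hu.trans hab.symm, hd⟩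
          rw [Set.indicator_of_notMem ha, Set.indicator_of_notMem hb]
  have hD : MeasurableSet {p : X × X | dist (g p.2) (g p.1) ≤ δ J} :=
    measurableSet_le ((hg.comp measurable_snd).dist (hg.comp measurable_fst)) measurable_const
  calc ∫⁻ x, μ (g ⁻¹' Metric.closedBall (g x) (δ J)) * E J x ∂μ
      = ∫⁻ x, ∫⁻ y, {p : X × X | dist (g p.2) (g p.1) ≤ δ J}.indicator
          (fun p => E J p.1) (x, y) ∂μ ∂μ := by
        refine lintegral_congr fun x => ?_
        have hm : MeasurableSet (g ⁻¹' Metric.closedBall (g x) (δ J)) :=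
          hg Metric.isClosed_closedBall.measurableSet
        rw [mul_comm, ← setLIntegral_const, ← lintegral_indicator hm]
        rfl
    _ = ∫⁻ y, ∫⁻ x, {p : X × X | dist (g p.2) (g p.1) ≤ δ J}.indicator
          (fun p => E J p.1) (x, y) ∂μ ∂μ := lintegral_lintegral_swap
        (((hEm J).comp measurable_fst).indicator hD).aemeasurable
    _ ≤ ∫⁻ _y, 1 ∂μ := lintegral_mono fun y => by
        refine le_trans (lintegral_mono fun x => ?_) (key (g y) J)
        by_cases hx : (x, y) ∈ {p : X × X | dist (g p.2) (g p.1) ≤ δ J}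
        · have : x ∈ {z | ∃ u, c J u = c J z ∧ dist (g u) (g y) ≤ δ J} :=
            ⟨x, rfl, by rw [dist_comm]; exact hx⟩
          rw [Set.indicator_of_mem hx, Set.indicator_of_mem this]
        · rw [Set.indicator_of_notMem hx]
          exact zero_le
    _ = 1 := by simp

omit [OpensMeasurableSpace Y] [SecondCountableTopology Y] [MeasurableSpace Y] in
-- All factors except the last are constant on the fibres of `c J`, and the last has mean at most
-- `1` there.
theorem lintegral_exp_sum_meanInfoGain_sub_le {s : ℝ} (hs : 0 ≤ s) (ht : 0 ≤ t)
    (hst : s * t ≤ 1) (hc : IsRefining c) (J : ℕ) :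
    ∫⁻ x, ENNReal.ofReal (Real.exp (∑ j ∈ Finset.range J,
      (s * (meanInfoGain μ (c j) (c (j + 1)) g (δ (j + 1)) t x -
        infoGain μ (c j) (c (j + 1)) g (δ (j + 1)) t x) - (s * t) ^ 2))) ∂μ ≤ 1 := by
  induction J with
  | zero => simp
  | succ J ih =>
    refine le_trans ?_ ih
    simp_rw [Finset.sum_range_succ, Real.exp_add]
    simp_rw [fun a b : ℝ => ENNReal.ofReal_mul (q := Real.exp b) (Real.exp_pos a).le]
    refine (hc.isCountablePartition J).lintegral_mul_le (fun x y hxy => ?_) fun x =>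
      setLIntegral_exp_meanInfoGain_sub_le hs ht hst (hc.isCountablePartition J)
        (hc.isCountablePartition _) (hc.eq_of_eq _ _ J.le_succ) x
    congr 2
    refine Finset.sum_congr rfl fun j hj => ?_
    have hj' := Finset.mem_range.1 hj
    rw [meanInfoGain_congr (hc.eq_of_eq j J hj'.le x y hxy),
      infoGain_congr (hc.eq_of_eq _ _ j.le_succ) (hc.eq_of_eq (j + 1) J hj' x y hxy)]

end Averages

section Averages

variable {X Y β : Type*} [MeasurableSpace X] [PseudoMetricSpace Y] [MeasurableSpace Y]
  [OpensMeasurableSpace Y] [SecondCountableTopology Y] {μ : Measure X} [IsProbabilityMeasure μ]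
  {c : ℕ → X → β} {g : X → Y} {δ : ℕ → ℝ} {t : ℝ}

/-- The image measure of a ball centred at `g x` is bounded in terms of the sum of the mean
information gains along the fibres containing `x`. -/
theorem ae_eventually_measureReal_closedBall_le (hc : IsRefining c) (hg : Measurable g)
    (hδ : Antitone δ) (ht : 0 ≤ t) {ε : ℝ} (hε : 0 < ε) :
    ∀ᵐ x ∂μ, ∀ᶠ J : ℕ in atTop, μ.real (g ⁻¹' Metric.closedBall (g x) (δ J)) ≤
      Real.exp (ε * J - ∑ j ∈ Finset.range J,
        meanInfoGain μ (c j) (c (j + 1)) g (δ (j + 1)) t x) := by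
  -- Half of `ε` pays for the quadratic error `s * t²` per step, the other half for the logarithms
  -- below.
  obtain ⟨s, hs, hst, hst2⟩ : ∃ s : ℝ, 0 < s ∧ s * t ≤ 1 ∧ s * t ^ 2 ≤ ε / 2 := by
    refine ⟨min (1 / (t + 1)) (ε / 2 / (t ^ 2 + 1)), by positivity, ?_, ?_⟩
    · refine (mul_le_mul_of_nonneg_right (min_le_left _ _) ht).trans ?_
      rw [one_div, inv_mul_le_iff₀ (by positivity)]
      linarith
    · refine (mul_le_mul_of_nonneg_right (min_le_right _ _) (sq_nonneg t)).trans ?_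
      rw [div_mul_eq_mul_div, div_le_iff₀ (by positivity)]
      nlinarith
  set I : ℕ → X → ℝ := fun j => infoGain μ (c j) (c (j + 1)) g (δ (j + 1)) t with hI
  set M : ℕ → X → ℝ := fun j => meanInfoGain μ (c j) (c (j + 1)) g (δ (j + 1)) t with hM
  have hIm : ∀ j, Measurable (I j) := fun j =>
    measurable_infoGain (hc.isCountablePartition _) (hc.eq_of_eq _ _ j.le_succ)
  have hMm : ∀ j, Measurable (M j) := fun j =>
    (hc.isCountablePartition j).measurable_of_constant fun _ _ => meanInfoGain_congr
  have hball : ∀ J, Measurable fun x => μ (g ⁻¹' Metric.closedBall (g x) (δ J)) := by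
    intro J
    have hD : MeasurableSet {p : X × X | dist (g p.2) (g p.1) ≤ δ J} :=
      measurableSet_le ((hg.comp measurable_snd).dist (hg.comp measurable_fst)) measurable_const
    exact measurable_measure_prodMk_left hD
  have h1 := ae_eventually_le_sq_of_lintegral_le_one (μ := μ)
    (F := fun J x => μ (g ⁻¹' Metric.closedBall (g x) (δ J)) * ENNReal.ofReal (Real.exp
      (∑ j ∈ Finset.range J, I j x)))
    (fun J => (hball J).mul (Real.measurable_exp.comp
      (Finset.measurable_sum _ fun j _ => hIm j)).ennreal_ofReal)
    (lintegral_measure_closedBall_mul_exp_sum_infoGain_le hc hg hδ)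
  have h2 := ae_eventually_le_sq_of_lintegral_le_one (μ := μ)
    (F := fun J x => ENNReal.ofReal (Real.exp (∑ j ∈ Finset.range J,
      (s * (M j x - I j x) - (s * t) ^ 2))))
    (fun J => (Real.measurable_exp.comp (Finset.measurable_sum _ fun j _ =>
      (((hMm j).sub (hIm j)).const_mul s).sub_const _)).ennreal_ofReal)
    (lintegral_exp_sum_meanInfoGain_sub_le hs.le ht hst hc)
  -- Both estimates lose a factor `(J + 1)²`; in the second one its logarithm is divided by `s`.
  have hlog : ∀ᶠ J : ℕ in atTop, 2 * (1 + s⁻¹) * Real.log (J + 1 : ℝ) ≤ ε / 2 * J := by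
    have hlit : (fun J : ℕ => Real.log (J + 1 : ℝ)) =o[atTop] fun J : ℕ => (J + 1 : ℝ) := by
      have := Real.isLittleO_log_id_atTop.comp_tendsto
        (tendsto_atTop_add_const_right atTop (1 : ℝ) tendsto_natCast_atTop_atTop)
      exact this
    have hη : 0 < ε / 8 / (1 + s⁻¹) := by positivity
    filter_upwards [hlit.bound hη, eventually_ge_atTop 1] with J hJ hJ1
    have hJ1' : (1 : ℝ) ≤ J := by exact_mod_cast hJ1
    rw [Real.norm_of_nonneg (Real.log_nonneg (by linarith)), Real.norm_of_nonneg (by positivity),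
      div_mul_eq_mul_div, le_div_iff₀ (by positivity)] at hJ
    nlinarith
  filter_upwards [h1, h2] with x hx1 hx2
  filter_upwards [hx1, hx2, hlog] with J hJ1 hJ2 hJ3
  set S := ∑ j ∈ Finset.range J, I j x
  have hJpos : (0 : ℝ) < J + 1 := by positivity
  have hsq : ((J : ℝ) + 1) ^ 2 = Real.exp (2 * Real.log (J + 1)) := by
    rw [two_mul, Real.exp_add, Real.exp_log hJpos, sq]
  rw [← ofReal_measureReal (μ := μ), ← ENNReal.ofReal_mul measureReal_nonneg,
    ENNReal.ofReal_le_ofReal_iff (by positivity), ← le_div_iff₀ (Real.exp_pos _), hsq,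
    ← Real.exp_sub] at hJ1
  rw [ENNReal.ofReal_le_ofReal_iff (by positivity), hsq, Real.exp_le_exp] at hJ2
  refine hJ1.trans (Real.exp_le_exp.2 ?_)
  have hsum : ∑ j ∈ Finset.range J, (s * (M j x - I j x) - (s * t) ^ 2) =
      s * (∑ j ∈ Finset.range J, M j x - S - s * t ^ 2 * J) := by
    rw [Finset.sum_sub_distrib, ← Finset.mul_sum, Finset.sum_sub_distrib]
    simp
    ring
  rw [hsum, ← le_inv_mul_iff₀ hs] at hJ2
  have h3 : s * t ^ 2 * J ≤ ε / 2 * J := by gcongr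
  change 2 * Real.log (J + 1) - S ≤ ε * J - ∑ j ∈ Finset.range J, M j x
  nlinarith

omit [MeasurableSpace X] in
theorem sum_range_mul_eq_sum_sum (f : ℕ → ℝ) (q J : ℕ) :
    ∑ n ∈ Finset.range (J * q), f n =
      ∑ r ∈ Finset.range q, ∑ j ∈ Finset.range J, f (r + j * q) := by
  rw [Finset.sum_comm]
  induction J with
  | zero => simp
  | succ J ih =>
    rw [Finset.sum_range_succ, ← ih, Nat.succ_mul, Finset.sum_range_add]
    simp [add_comm]

theorem IsRefining.subsequence (hc : IsRefining c) (r q : ℕ) :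
    IsRefining fun j => c (r + j * q) :=
  ⟨fun _ => hc.isCountablePartition _, fun m n hmn => hc.eq_of_eq _ _ (by gcongr)⟩

/-- The local entropy averages lemma: a lower bound for the averages of the mean information gains
between the `n`-th and the `n + q`-th partition yields an upper bound for the image measures of
balls. -/
theorem ae_forall_eventually_measureReal_closedBall_le {ρ : ℝ} (hρ0 : 0 < ρ) (hρ1 : ρ < 1)
    (hc : IsRefining c) (hg : Measurable g) (ht : 0 ≤ t) {ε : ℝ} (hε : 0 < ε) {q : ℕ}
    (hq : 0 < q) :
    ∀ᵐ x ∂μ, ∀ a : ℝ, (∀ᶠ N : ℕ in atTop, a * N ≤ ∑ n ∈ Finset.range N,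
        meanInfoGain μ (c n) (c (n + q)) g (ρ ^ (n + q)) t x) →
      ∀ᶠ J : ℕ in atTop, μ.real (g ⁻¹' Metric.closedBall (g x) (ρ ^ ((J + 1) * q))) ≤
        Real.exp (-(a - ε) * J) := by
  have h := fun r : ℕ => ae_eventually_measureReal_closedBall_le (μ := μ) (hc.subsequence r q) hg
    (δ := fun j => ρ ^ (r + j * q)) (fun i j hij => pow_le_pow_of_le_one hρ0.le hρ1.le
      (by gcongr)) ht hε
  have h' : ∀ᵐ x ∂μ, ∀ r : ℕ, _ := ae_all_iff.2 h
  filter_upwards [h'] with x hx a ha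
  have hx' : ∀ᶠ J : ℕ in atTop, ∀ r ∈ Finset.range q, _ :=
    (Filter.eventually_all_finset (Finset.range q)).2 fun r _ => hx r
  have hJq : Tendsto (fun J : ℕ => J * q) atTop atTop := tendsto_id.atTop_mul_const' hq
  filter_upwards [hx', hJq.eventually ha] with J hJ haJ
  set b := μ.real (g ⁻¹' Metric.closedBall (g x) (ρ ^ ((J + 1) * q)))
  set f : ℕ → ℝ := fun n => meanInfoGain μ (c n) (c (n + q)) g (ρ ^ (n + q)) t x
  have hb : ∀ r ∈ Finset.range q, b ≤ Real.exp (ε * J - ∑ j ∈ Finset.range J, f (r + j * q)) := by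
    intro r hr
    have h1 := hJ r hr
    have h2 : ∀ j, f (r + j * q) = meanInfoGain μ (c (r + j * q)) (c (r + (j + 1) * q)) g
        (ρ ^ (r + (j + 1) * q)) t x := by
      intro j
      have : r + (j + 1) * q = r + j * q + q := by ring
      simp only [f, this]
    simp_rw [h2]
    refine le_trans (measureReal_mono (Set.preimage_mono (Metric.closedBall_subset_closedBall ?_)))
      h1
    refine pow_le_pow_of_le_one hρ0.le hρ1.le ?_
    have := Finset.mem_range.1 hr
    rw [Nat.succ_mul]
    omega
  -- Each residue class `r` modulo `q` bounds the same mass `b`. Multiplying the `q` bounds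
  -- assembles the full sum over `n < J * q`, for which the hypothesis on averages is available.
  have hprod : b ^ q ≤ Real.exp (-(a - ε) * J) ^ q := by
    calc b ^ q = ∏ _r ∈ Finset.range q, b := by simp
      _ ≤ ∏ r ∈ Finset.range q, Real.exp (ε * J - ∑ j ∈ Finset.range J, f (r + j * q)) :=
        Finset.prod_le_prod (fun _ _ => measureReal_nonneg) hb
      _ = Real.exp (q * (ε * J) - ∑ n ∈ Finset.range (J * q), f n) := by
        rw [← Real.exp_sum, Finset.sum_sub_distrib, sum_range_mul_eq_sum_sum]
        simp
      _ ≤ _ := by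
        rw [← Real.exp_nat_mul, Real.exp_le_exp]
        push_cast at haJ
        linarith
  exact (pow_le_pow_iff_left₀ measureReal_nonneg (Real.exp_pos _).le hq.ne').1 hprod

end Averages

/-! ### Markov laws -/

section Markov

variable {S : Type*} [MeasurableSpace S]

/-- Append a state to the history of a process up to time `n`. -/
def appendState (n : ℕ) (p : (Finset.Iic n → S) × S) (i : Finset.Iic (n + 1)) : S :=
  if h : (i : ℕ) ≤ n then p.1 ⟨i, Finset.mem_Iic.2 h⟩ else p.2

theorem measurable_appendState (n : ℕ) : Measurable (appendState (S := S) n) := by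
  refine measurable_pi_lambda _ fun i => ?_
  by_cases h : (i : ℕ) ≤ n
  · simp only [appendState, h, dif_pos]
    fun_prop
  · simp only [appendState, h, dif_neg, not_false_iff]
    fun_prop

omit [MeasurableSpace S] in
theorem appendState_history (n : ℕ) (ω : ℕ → S) :
    appendState n (Preorder.frestrictLe n ω, ω (n + 1)) = Preorder.frestrictLe (n + 1) ω := by
  funext i
  have hi := Finset.mem_Iic.1 i.2
  by_cases h : (i : ℕ) ≤ n
  · simp [appendState, h]
  · have : (i : ℕ) = n + 1 := by omega
    simp [appendState, this]

/-- The kernel which gives the law of the state at time `n + 1` in terms of the history. -/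
noncomputable def historyKernel (κ : Kernel S S) (n : ℕ) : Kernel (Finset.Iic n → S) S :=
  κ.comap (fun h : Finset.Iic n → S => h ⟨n, Finset.mem_Iic.2 le_rfl⟩) (measurable_pi_apply _)

instance (κ : Kernel S S) [IsMarkovKernel κ] (n : ℕ) : IsMarkovKernel (historyKernel κ n) := by
  unfold historyKernel; infer_instance

theorem isMarkovLaw_iff {κ : Kernel S S} {P : Measure (ℕ → S)} :
    IsMarkovLaw κ P ↔ ∀ n, P.map (fun ω => (Preorder.frestrictLe n ω, ω (n + 1))) =
      P.map (Preorder.frestrictLe n) ⊗ₘ historyKernel κ n := Iff.rfl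

theorem map_frestrictLe_succ (P : Measure (ℕ → S)) (n : ℕ) :
    P.map (Preorder.frestrictLe (n + 1)) =
      (P.map (fun ω => (Preorder.frestrictLe n ω, ω (n + 1)))).map (appendState n) := by
  rw [Measure.map_map (measurable_appendState n) (by fun_prop)]
  congr 1
  funext ω
  exact (appendState_history n ω).symm

theorem map_frestrictLe_zero (P : Measure (ℕ → S)) :
    P.map (Preorder.frestrictLe 0) = (P.map fun ω => ω 0).map (fun s _ => s) := by
  rw [Measure.map_map (by fun_prop) (by fun_prop)]
  congr 1
  funext ω i
  have : (i : ℕ) = 0 := Nat.le_zero.1 (Finset.mem_Iic.1 i.2)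
  simp [this]

/-- This is uniqueness of projective limits: the laws of the initial segments determine all
finite-dimensional distributions. -/
theorem eq_of_map_frestrictLe_eq {P Q : Measure (ℕ → S)} [IsFiniteMeasure P] [IsFiniteMeasure Q]
    (h : ∀ n, P.map (Preorder.frestrictLe n) = Q.map (Preorder.frestrictLe n)) : P = Q := by
  have hP : IsProjectiveLimit P fun I : Finset ℕ => P.map I.restrict := fun I => rfl
  have hfam : IsProjectiveMeasureFamily (α := fun _ : ℕ => S)
      fun I : Finset ℕ => P.map I.restrict :=
    isProjectiveMeasureFamily_map_restrict (P := P) (X := fun n ω => ω n)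
      fun t => (measurable_pi_apply t).aemeasurable
  have hQ : IsProjectiveLimit Q fun I : Finset ℕ => P.map I.restrict :=
    (isProjectiveLimit_nat_iff hfam Q).2 fun n => (h n).symm
  exact hP.unique hQ

theorem IsMarkovLaw.eq_of_initial_eq {κ : Kernel S S} {P Q : Measure (ℕ → S)} [IsFiniteMeasure P]
    [IsFiniteMeasure Q] (hP : IsMarkovLaw κ P) (hQ : IsMarkovLaw κ Q)
    (h : P.map (fun ω => ω 0) = Q.map fun ω => ω 0) : P = Q := by
  refine eq_of_map_frestrictLe_eq fun n => ?_
  induction n with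
  | zero => rw [map_frestrictLe_zero, map_frestrictLe_zero, h]
  | succ n ih =>
    rw [map_frestrictLe_succ, map_frestrictLe_succ, isMarkovLaw_iff.1 hP, isMarkovLaw_iff.1 hQ, ih]

/-- The law of the Markov process with kernel `κ` started from the distribution `ν`. -/
noncomputable def markovLaw (κ : Kernel S S) [IsMarkovKernel κ] (ν : Measure S) : Measure (ℕ → S) :=
  Kernel.trajMeasure (X := fun _ => S) ν (historyKernel κ)

variable (κ : Kernel S S) [IsMarkovKernel κ] (ν : Measure S) [IsProbabilityMeasure ν]

instance : IsProbabilityMeasure (markovLaw κ ν) := by unfold markovLaw; infer_instance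

theorem isMarkovLaw_markovLaw : IsMarkovLaw κ (markovLaw κ ν) := fun n =>
  (Kernel.map_frestrictLe_trajMeasure_compProd_eq_map_trajMeasure (X := fun _ => S)
    (κ := historyKernel κ) (μ₀ := ν) (a := n)).symm

omit [IsProbabilityMeasure ν] in
theorem map_zero_markovLaw : (markovLaw κ ν).map (fun ω => ω 0) = ν := by
  have h1 : (markovLaw κ ν).map (Preorder.frestrictLe 0) =
      ν.map (MeasurableEquiv.piUnique fun _ : Finset.Iic 0 => S).symm := by
    rw [markovLaw, Kernel.trajMeasure, Measure.map_comp _ _ (by fun_prop),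
      Kernel.traj_map_frestrictLe, Kernel.partialTraj_self, Measure.id_comp]
  have h2 : (markovLaw κ ν).map (fun ω => ω 0) =
      ((markovLaw κ ν).map (Preorder.frestrictLe 0)).map fun h => h ⟨0, Finset.mem_Iic.2 le_rfl⟩ := by
    rw [Measure.map_map (by fun_prop) (by fun_prop)]
    rfl
  rw [h2, h1, Measure.map_map (by fun_prop) (by fun_prop)]
  exact Measure.map_id

omit [IsProbabilityMeasure ν] in
-- The law started from `ν` is the `ν`-mixture of the laws started from points.
theorem ae_ae_markovLaw_dirac {p : (ℕ → S) → Prop} (h : ∀ᵐ ω ∂(markovLaw κ ν), p ω) :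
    ∀ᵐ s ∂ν, ∀ᵐ ω ∂(markovLaw κ (Measure.dirac s)), p ω := by
  rw [markovLaw, Kernel.trajMeasure] at h
  have h1 := ae_of_ae_map (by fun_prop) (Measure.ae_ae_of_ae_comp h)
  filter_upwards [h1] with s hs
  have hm : Measurable (MeasurableEquiv.piUnique fun _ : Finset.Iic 0 => S).symm := by fun_prop
  have h2 : markovLaw κ (Measure.dirac s) = Kernel.traj (X := fun _ => S) (historyKernel κ) 0
      ((MeasurableEquiv.piUnique fun _ : Finset.Iic 0 => S).symm s) := by
    rw [markovLaw, Kernel.trajMeasure]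
    have h3 := Measure.map_dirac' hm s
    have h4 := Measure.dirac_bind (Kernel.measurable (Kernel.traj (X := fun _ => S)
      (historyKernel κ) 0)) ((MeasurableEquiv.piUnique fun _ : Finset.Iic 0 => S).symm s)
    rw [← h4, ← h3]
  rw [h2]
  exact hs

theorem IsMarkovLaw.ae_ae_markovLaw_dirac {P : Measure (ℕ → S)} [IsProbabilityMeasure P]
    (hP : IsMarkovLaw κ P) {p : (ℕ → S) → Prop} (h : ∀ᵐ ω ∂P, p ω) :
    ∀ᵐ s ∂(P.map fun ω => ω 0), ∀ᵐ ω ∂(markovLaw κ (Measure.dirac s)), p ω := by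
  have : IsProbabilityMeasure (P.map fun ω => ω 0) :=
    Measure.isProbabilityMeasure_map (measurable_pi_apply 0).aemeasurable
  refine _root_.ae_ae_markovLaw_dirac κ _ ?_
  rwa [(isMarkovLaw_markovLaw κ _).eq_of_initial_eq hP (map_zero_markovLaw κ _)]

end Markov

/-! ### Singletons in the space of measures -/

/-- A finite measure is determined by its values on a countable generating algebra. Singletons are
needed so that a state visited with positive probability can be kept out of a null event. -/
theorem measurableSet_singleton_measure {X : Type*} [MeasurableSpace X]
    [MeasurableSpace.CountablyGenerated X] (ν : Measure X) [IsFiniteMeasure ν] :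
    MeasurableSet ({ν} : Set (Measure X)) := by
  set 𝒜 := generateSetAlgebra (MeasurableSpace.countableGeneratingSet X)
  have hgen : MeasurableSpace.generateFrom 𝒜 = ‹MeasurableSpace X› := by
    rw [generateFrom_generateSetAlgebra_eq, MeasurableSpace.generateFrom_countableGeneratingSet]
  have halg : IsSetAlgebra 𝒜 := isSetAlgebra_generateSetAlgebra
  have hcount : 𝒜.Countable :=
    countable_generateSetAlgebra MeasurableSpace.countable_countableGeneratingSet
  have : ({ν} : Set (Measure X)) = ⋂ A ∈ 𝒜, {μ | μ A = ν A} := by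
    ext μ
    simp only [Set.mem_singleton_iff, Set.mem_iInter]
    refine ⟨fun h A _ => by rw [h]; rfl, fun h => Eq.symm ?_⟩
    exact ext_of_generate_finite 𝒜 hgen.symm (fun s hs t ht _ => halg.inter_mem hs ht)
      (fun A hA => (h A hA).symm) (h _ halg.univ_mem).symm
  rw [this]
  refine .biInter hcount fun A hA => ?_
  have hAm : MeasurableSet A := by
    rw [← hgen]; exact MeasurableSpace.measurableSet_generateFrom hA
  exact Measure.measurable_coe hAm (measurableSet_singleton _)

/-! ### The law of a CP-chain given its initial state -/

section Paths

variable {d : ℕ}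

theorem rescaledMeasure_univ_le (μ : Measure (Fin d → ℝ)) (B : Box d) :
    rescaledMeasure μ B Set.univ ≤ 1 := by
  rw [rescaledMeasure, Measure.map_apply B.measurable_rescale .univ]
  exact prob_le_one

instance (μ : Measure (Fin d → ℝ)) (B : Box d) : IsFiniteMeasure (rescaledMeasure μ B) :=
  ⟨(rescaledMeasure_univ_le μ B).trans_lt ENNReal.one_lt_top⟩

theorem measurableSet_singleton_cpState (s : CPState d) [IsFiniteMeasure s.1] :
    MeasurableSet ({s} : Set (CPState d)) := by
  rw [← Prod.mk.eta (p := s), ← Set.singleton_prod_singleton]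
  exact (measurableSet_singleton_measure s.1).prod (measurableSet_singleton s.2)

theorem rescaledMeasure_normalize {μ : Measure (Fin d → ℝ)} [IsProbabilityMeasure μ] {A : Box d}
    (h : μ A.normalize.toSet = 1) : rescaledMeasure μ A.normalize = μ := by
  have hae : A.normalize.toSet =ᵐ[μ] Set.univ :=
    eventuallyEq_univ.2 ((prob_compl_eq_zero_iff A.normalize.measurableSet_toSet).2 h)
  rw [rescaledMeasure, Box.rescale_normalize, Measure.map_id, ProbabilityTheory.cond, h,
    Measure.restrict_congr_set hae, Measure.restrict_univ]
  simp

/-- Conditioning on `D` and then on `E ⊆ D` is conditioning on `E`, and the two homotheties compose.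
This is why the chain, which only sees normalized boxes, magnifies the original measure. -/
theorem rescaledMeasure_relative {μ : Measure (Fin d → ℝ)} [IsFiniteMeasure μ] {D E : Box d}
    (h : E.toSet ⊆ D.toSet) :
    rescaledMeasure (rescaledMeasure μ D) (Box.relative D E) = rescaledMeasure μ E := by
  have hD := D.measurable_rescale
  have hpre : D.rescale ⁻¹' (Box.relative D E).toSet = E.toSet := by
    ext x; simp
  have hcond : cond ((cond μ D.toSet).map D.rescale) (Box.relative D E).toSet =
      (cond μ E.toSet).map D.rescale := by
    rw [ProbabilityTheory.cond, Measure.restrict_map hD (Box.measurableSet_toSet _),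
      Measure.map_apply hD (Box.measurableSet_toSet _), hpre, ← Measure.map_smul,
      ← ProbabilityTheory.cond, cond_cond_eq_cond_inter D.measurableSet_toSet
      E.measurableSet_toSet, Set.inter_eq_right.2 h]
  rw [rescaledMeasure, rescaledMeasure, rescaledMeasure, hcond,
    Measure.map_map (Box.measurable_rescale _) hD]
  congr 1
  funext x
  exact Box.rescale_relative D E x

theorem rescaledMeasure_apply_relative {μ : Measure (Fin d → ℝ)} (D E : Box d) :
    rescaledMeasure μ D (Box.relative D E).toSet = cond μ D.toSet E.toSet := by
  rw [rescaledMeasure, Measure.map_apply D.measurable_rescale (Box.measurableSet_toSet _)]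
  congr 1
  ext x; simp

variable (Δ : PartitionOperator d)

/-- The path of the chain which starts in the state `s` and follows the cells containing `x`. -/
noncomputable def cpPath (s : CPState d) : (Fin d → ℝ) → ℕ → CPState d
  | _, 0 => s
  | x, n + 1 => (rescaledMeasure s.1 (Δ.cell s.2.normalize (n + 1) x),
      Box.relative (Δ.cell s.2.normalize n x) (Δ.cell s.2.normalize (n + 1) x))

/-- The cells of `A` together with the complement of `A`. -/
noncomputable def cellPartition (A : Box d) (n : ℕ) (x : Fin d → ℝ) : Prop × Box d :=
  (x ∈ A.toSet, Δ.cell A n x)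

variable {Δ} {s : CPState d}

theorem cell_of_notMem {A : Box d} (hA : A ∈ Δ.family) {x : Fin d → ℝ} (hx : x ∉ A.toSet) (n : ℕ) :
    Δ.cell A n x = A := by
  induction n with
  | zero => rfl
  | succ n ih =>
    rw [PartitionOperator.cell, ih]
    exact PartitionOperator.child_of_notMem hA hx

theorem isRefining_cellPartition {A : Box d} (hA : A ∈ Δ.family) :
    IsRefining (cellPartition Δ A) := by
  refine ⟨fun n => ⟨?_, fun b => ?_⟩, fun m n hmn => ?_⟩
  · have : Set.range (cellPartition Δ A n) ⊆ Set.univ ×ˢ Set.range (Δ.cell A n) := by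
      rintro _ ⟨x, rfl⟩
      exact ⟨trivial, x, rfl⟩
    exact (Set.countable_univ.prod (PartitionOperator.range_cell_countable hA n)).mono this
  · have : cellPartition Δ A n ⁻¹' {b} = {x | (x ∈ A.toSet) = b.1} ∩ Δ.cell A n ⁻¹' {b.2} := by
      ext x
      simp [cellPartition, Prod.ext_iff]
    rw [this]
    refine .inter ?_ (PartitionOperator.measurableSet_cell_preimage hA n b.2)
    by_cases hb : b.1
    · simpa [hb] using A.measurableSet_toSet
    · have h : {x | (x ∈ A.toSet) = b.1} = A.toSetᶜ := by ext; simp [hb]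
      rw [h]
      exact A.measurableSet_toSet.compl
  · induction n, hmn using Nat.le_induction with
    | base => exact fun x y h => h
    | succ n hmn ih =>
      intro x y h
      refine ih x y ?_
      obtain ⟨h1, h2⟩ := Prod.ext_iff.1 h
      refine Prod.ext h1 ?_
      have h1' : x ∈ A.toSet ↔ y ∈ A.toSet := iff_of_eq h1
      by_cases hx : x ∈ A.toSet
      · exact PartitionOperator.cell_eq_of_cell_succ_eq hA n hx (h1'.1 hx) h2
      · change Δ.cell A n x = Δ.cell A n y
        rw [cell_of_notMem hA hx, cell_of_notMem hA fun hy => hx (h1'.2 hy)]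

/-- Outside `A` the map `cell` takes the default value `A`; the recorded membership in `A` keeps
those points out of the fibre. -/
theorem cellPartition_preimage {A : Box d} (hA : A ∈ Δ.family) {x : Fin d → ℝ}
    (hx : x ∈ A.toSet) (n : ℕ) :
    cellPartition Δ A n ⁻¹' {cellPartition Δ A n x} = (Δ.cell A n x).toSet := by
  rw [← PartitionOperator.preimage_cell_inter hA hx n]
  ext y
  simp [cellPartition, hx, and_comm]

theorem cpPath_congr (hA : s.2.normalize ∈ Δ.family) {n m : ℕ} (hmn : m ≤ n) {x y : Fin d → ℝ}
    (h : cellPartition Δ s.2.normalize n x = cellPartition Δ s.2.normalize n y) :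
    cpPath Δ s x m = cpPath Δ s y m := by
  have hr := isRefining_cellPartition hA
  cases m with
  | zero => rfl
  | succ m =>
    have h1 := (Prod.ext_iff.1 (hr.eq_of_eq (m + 1) n hmn x y h)).2
    have h2 := (Prod.ext_iff.1 (hr.eq_of_eq m n (by omega) x y h)).2
    simp only [cellPartition] at h1 h2
    rw [cpPath, cpPath, h1, h2]

theorem measurable_cpPath_apply (hA : s.2.normalize ∈ Δ.family) (n : ℕ) :
    Measurable fun x => cpPath Δ s x n :=
  ((isRefining_cellPartition hA).isCountablePartition n).measurable_of_constant
    fun _ _ h => cpPath_congr hA le_rfl h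

theorem measurable_cpPath (hA : s.2.normalize ∈ Δ.family) : Measurable (cpPath Δ s) :=
  measurable_pi_lambda _ fun n => measurable_cpPath_apply hA n

theorem cpPath_snd_normalize (n : ℕ) (x : Fin d → ℝ) :
    (cpPath Δ s x n).2.normalize = (Δ.cell s.2.normalize n x).normalize := by
  cases n with
  | zero => exact (Box.normalize_normalize _).symm
  | succ n => exact Box.normalize_relative _ _

theorem cpPath_fst (hs : IsCPState Δ s) (n : ℕ) (x : Fin d → ℝ) :
    (cpPath Δ s x n).1 = rescaledMeasure s.1 (Δ.cell s.2.normalize n x) := by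
  have := hs.2.2.1
  cases n with
  | zero => exact (rescaledMeasure_normalize hs.2.2.2).symm
  | succ n => rfl

theorem isFiniteMeasure_cpPath_fst (hs : IsCPState Δ s) (n : ℕ) (x : Fin d → ℝ) :
    IsFiniteMeasure (cpPath Δ s x n).1 := by
  rw [cpPath_fst hs]; infer_instance

/-- The transition law from the state of the path of `x` at time `n` is the conditional law of the
state at time `n + 1` on the cell of `x`. -/
theorem cpTransition_cpPath (hs : IsCPState Δ s) (n : ℕ) {x : Fin d → ℝ}
    (hx : x ∈ s.2.normalize.toSet) (hn : IsCPState Δ (cpPath Δ s x n)) :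
    cpTransition Δ (cpPath Δ s x n) =
      (cond s.1 (Δ.cell s.2.normalize n x).toSet).map fun y => cpPath Δ s y (n + 1) := by
  have hμ := hs.2.2.1
  have hA := hs.2.1
  have hn2 := hn.2.1
  set D := Δ.cell s.2.normalize n x with hD
  have hDf : D ∈ Δ.family := PartitionOperator.cell_mem_family hA n x
  rw [cpPath_snd_normalize, ← hD] at hn2
  -- The chain partitions the normalized box, the cells partition `D` itself. Invariance of `Δ`
  -- identifies the two, for which both boxes must belong to the family.
  have hpart : Δ.part (cpPath Δ s x n).2.normalize = Box.relative D '' Δ.part D := by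
    rw [cpPath_snd_normalize, ← hD]
    exact Δ.part_normalize hDf hn2
  have hinj : Function.Injective (Box.relative D) := Box.homothety_injective _ D.scale_pos _
  ext W hW
  rw [cpTransition, Measure.sum_apply _ hW,
    Measure.map_apply (measurable_cpPath_apply hA (n + 1)) hW, cpPath_fst hs, ← hD]
  simp only [Measure.smul_apply, smul_eq_mul]
  have hcell : ∀ E ∈ Δ.part D, ∀ y ∈ E.toSet, cpPath Δ s y (n + 1) =
      (rescaledMeasure s.1 E, Box.relative D E) := by
    intro E hE y hy
    have hyD : y ∈ D.toSet := PartitionOperator.toSet_subset_of_mem_part hDf hE hy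
    have h1 : Δ.cell s.2.normalize n y = D := PartitionOperator.cell_eq_of_mem hA hx n hyD
    have h2 : Δ.cell s.2.normalize (n + 1) y = E := by
      rw [PartitionOperator.cell, h1]
      exact PartitionOperator.child_eq hDf hE hy
    rw [cpPath, h1, h2]
  set F : Box d → ℝ≥0∞ := fun B => rescaledMeasure s.1 D B.toSet *
    Measure.dirac (rescaledMeasure (rescaledMeasure s.1 D) B, B) W with hF
  have hsum : ∑' B : Δ.part (cpPath Δ s x n).2.normalize, F B = ∑' E : Δ.part D,
      F (Box.relative D E) := by
    rw [hpart]
    exact tsum_image F hinj.injOn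
  refine hsum.trans ?_
  have hterm : ∀ E : Δ.part D, F (Box.relative D E) =
      cond s.1 D.toSet (E.1.toSet ∩ (fun y => cpPath Δ s y (n + 1)) ⁻¹' W) := by
    rintro ⟨E, hE⟩
    simp only [hF]
    rw [rescaledMeasure_apply_relative,
      rescaledMeasure_relative (PartitionOperator.toSet_subset_of_mem_part hDf hE),
      Measure.dirac_apply' _ hW]
    by_cases hmem : (rescaledMeasure s.1 E, Box.relative D E) ∈ W
    · have : E.toSet ∩ (fun y => cpPath Δ s y (n + 1)) ⁻¹' W = E.toSet :=
        Set.inter_eq_left.2 fun y hy => by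
          rw [Set.mem_preimage, hcell E hE y hy]; exact hmem
      rw [this, Set.indicator_of_mem hmem]
      simp
    · have : E.toSet ∩ (fun y => cpPath Δ s y (n + 1)) ⁻¹' W = ∅ := by
        refine Set.eq_empty_of_forall_notMem fun y hy => hmem ?_
        have := hy.2
        rwa [Set.mem_preimage, hcell E hE y hy.1] at this
      rw [this, Set.indicator_of_notMem hmem]
      simp
  have hcount : Countable (Δ.part D) := (Δ.countable_part hDf).to_subtype
  have hWm : MeasurableSet ((fun y => cpPath Δ s y (n + 1)) ⁻¹' W) :=
    measurable_cpPath_apply hA (n + 1) hW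
  rw [tsum_congr hterm, ← measure_iUnion]
  · have hU : (⋃ E : Δ.part D, E.1.toSet ∩ (fun y => cpPath Δ s y (n + 1)) ⁻¹' W) =
        D.toSet ∩ (fun y => cpPath Δ s y (n + 1)) ⁻¹' W := by
      rw [← Set.iUnion_inter, ← Δ.iUnion_eq D hDf, Set.biUnion_eq_iUnion]
    rw [hU, cond_inter_self D.measurableSet_toSet]
  · intro E F hEF
    exact (Δ.pairwise_disjoint D hDf E.2 F.2 fun h => hEF (Subtype.ext h)).mono
      Set.inter_subset_left Set.inter_subset_left
  · exact fun E => E.1.measurableSet_toSet.inter hWm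

/-- This is the law of total probability for the partition. -/
theorem IsCountablePartition.lintegral_cond_eq {X β : Type*} [MeasurableSpace X] {c : X → β}
    (hc : IsCountablePartition c) (μ : Measure X) [IsFiniteMeasure μ] {V : Set X}
    (hV : MeasurableSet V) : ∫⁻ x, cond μ (c ⁻¹' {c x}) V ∂μ = μ V := by
  rw [← lintegral_indicator_one hV, hc.lintegral_eq_tsum, hc.lintegral_eq_tsum]
  refine tsum_congr ?_
  rintro ⟨_, x, rfl⟩
  have hm := hc.measurableSet_preimage (c x)
  have h1 : ∀ z ∈ c ⁻¹' {c x}, cond μ (c ⁻¹' {c z}) V = cond μ (c ⁻¹' {c x}) V := fun z hz => by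
    rw [show c z = c x from hz]
  rw [setLIntegral_congr_fun hm h1, setLIntegral_const, lintegral_indicator_one hV,
    Measure.restrict_apply hV, Set.inter_comm, mul_comm]
  rcases eq_or_ne (μ (c ⁻¹' {c x})) 0 with h0 | h0
  · rw [h0, zero_mul, measure_inter_null_of_null_left _ h0]
  · rw [mul_comm]
    exact cond_mul_eq_inter hm V μ

end Paths

section PathLaw

variable {d : ℕ} {Δ : PartitionOperator d} {s : CPState d}

/-- The path up to time `n` depends only on the fibre of `cellPartition` at level `n`. Total
probability over these fibres reduces the Markov property to `cpTransition_cpPath`. -/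
theorem map_cpPath_succ (hs : IsCPState Δ s) (κ : Kernel (CPState d) (CPState d))
    [IsMarkovKernel κ] (n : ℕ) (h : ∀ᵐ x ∂s.1, IsCPState Δ (cpPath Δ s x n) ∧
      κ (cpPath Δ s x n) = cpTransition Δ (cpPath Δ s x n)) :
    (s.1.map (cpPath Δ s)).map (fun ω => (Preorder.frestrictLe n ω, ω (n + 1))) =
      (s.1.map (cpPath Δ s)).map (Preorder.frestrictLe n) ⊗ₘ historyKernel κ n := by
  have hμ := hs.2.2.1
  have hA := hs.2.1
  have hpm : Measurable (cpPath Δ s) := measurable_cpPath hA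
  have hc := (isRefining_cellPartition hA).isCountablePartition n
  have hmem : s.2.normalize.toSet ∈ ae s.1 :=
    (mem_ae_iff_prob_eq_one s.2.normalize.measurableSet_toSet).2 hs.2.2.2
  ext W hW
  have hV : MeasurableSet ((fun x => ((Preorder.frestrictLe n (cpPath Δ s x) :
      Finset.Iic n → CPState d), cpPath Δ s x (n + 1))) ⁻¹' W) := by
    refine Measurable.prodMk ?_ ?_ hW
    · exact (by fun_prop : Measurable (Preorder.frestrictLe (π := fun _ => CPState d) n)).comp hpm
    · exact measurable_cpPath_apply hA (n + 1)
  rw [Measure.compProd_apply hW, Measure.map_apply (by fun_prop) hW,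
    Measure.map_apply hpm ((by fun_prop : Measurable fun ω : ℕ → CPState d =>
      ((Preorder.frestrictLe n ω : Finset.Iic n → CPState d), ω (n + 1))) hW),
    lintegral_map (Kernel.measurable_kernel_prodMk_left hW) (by fun_prop),
    lintegral_map (f := fun ω : ℕ → CPState d => historyKernel κ n (Preorder.frestrictLe n ω)
      (Prod.mk (Preorder.frestrictLe n ω) ⁻¹' W))
      ((Kernel.measurable_kernel_prodMk_left hW).comp (by fun_prop)) hpm]
  change s.1 ((fun x => ((Preorder.frestrictLe n (cpPath Δ s x) :
      Finset.Iic n → CPState d), cpPath Δ s x (n + 1))) ⁻¹' W) = _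
  rw [← hc.lintegral_cond_eq s.1 hV]
  refine lintegral_congr_ae ?_
  filter_upwards [h, hmem] with x hx hxA
  have hκ : historyKernel κ n (Preorder.frestrictLe n (cpPath Δ s x)) =
      cpTransition Δ (cpPath Δ s x n) := hx.2
  have hsec : MeasurableSet (Prod.mk (Preorder.frestrictLe n (cpPath Δ s x) :
      Finset.Iic n → CPState d) ⁻¹' W) := measurable_prodMk_left hW
  have hD := PartitionOperator.measurableSet_cell_preimage hA n (Δ.cell s.2.normalize n x)
  rw [hκ, cpTransition_cpPath hs n hxA hx.1, Measure.map_apply (measurable_cpPath_apply hA _) hsec,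
    cellPartition_preimage hA hxA, cond_apply (Box.measurableSet_toSet _),
    cond_apply (Box.measurableSet_toSet _)]
  congr 2
  ext y
  simp only [Set.mem_inter_iff, Set.mem_preimage]
  refine and_congr_right fun hy => ?_
  have hyc : cellPartition Δ s.2.normalize n y = cellPartition Δ s.2.normalize n x := by
    rw [← cellPartition_preimage hA hxA] at hy; exact hy
  have : (Preorder.frestrictLe n (cpPath Δ s y) : Finset.Iic n → CPState d) =
      Preorder.frestrictLe n (cpPath Δ s x) := by
    funext i
    exact cpPath_congr hA (Finset.mem_Iic.1 i.2) hyc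
  rw [this]

/-- A Markov process which moves according to the transition law of CP-chains and starts in the
state `(μ, A)` follows the cells which contain a `μ`-random point. -/
theorem markovLaw_dirac_eq_map_cpPath (hs : IsCPState Δ s) (κ : Kernel (CPState d) (CPState d))
    [IsMarkovKernel κ] (h : ∀ᵐ ω ∂(markovLaw κ (Measure.dirac s)), ∀ n,
      IsCPState Δ (ω n) ∧ κ (ω n) = cpTransition Δ (ω n)) :
    markovLaw κ (Measure.dirac s) = s.1.map (cpPath Δ s) := by
  have hμ := hs.2.2.1
  have hA := hs.2.1
  have hpm : Measurable (cpPath Δ s) := measurable_cpPath hA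
  have : IsProbabilityMeasure (s.1.map (cpPath Δ s)) :=
    Measure.isProbabilityMeasure_map hpm.aemeasurable
  refine eq_of_map_frestrictLe_eq fun n => ?_
  induction n with
  | zero =>
    rw [map_frestrictLe_zero, map_frestrictLe_zero, map_zero_markovLaw,
      Measure.map_map (measurable_pi_apply 0) hpm]
    congr 1
    change _ = s.1.map fun _ => s
    rw [Measure.map_const, measure_univ, one_smul]
  | succ n ih =>
    -- By the induction hypothesis both processes have the same law at time `n`. The path takes
    -- countably many values there, so a bad one of positive mass would be an atom inside the event
    -- that `h` declares null.
    have hstep : ∀ᵐ x ∂s.1, IsCPState Δ (cpPath Δ s x n) ∧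
        κ (cpPath Δ s x n) = cpTransition Δ (cpPath Δ s x n) := by
      filter_upwards [((isRefining_cellPartition hA).isCountablePartition
        n).ae_measure_fiber_ne_zero (μ := s.1)] with x hx
      by_contra hne
      have := isFiniteMeasure_cpPath_fst hs n x
      have hsing := measurableSet_singleton_cpState (cpPath Δ s x n)
      have hlaw : (markovLaw κ (Measure.dirac s)).map (fun ω => ω n) =
          (s.1.map (cpPath Δ s)).map fun ω => ω n := by
        have h1 := congrArg (Measure.map fun h : Finset.Iic n → CPState d =>
          h ⟨n, Finset.mem_Iic.2 le_rfl⟩) ih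
        rwa [Measure.map_map (by fun_prop) (by fun_prop),
          Measure.map_map (by fun_prop) (by fun_prop)] at h1
      have h1 := DFunLike.congr_fun hlaw {cpPath Δ s x n}
      rw [Measure.map_apply (measurable_pi_apply n) hsing,
        Measure.map_apply (measurable_pi_apply n) hsing,
        Measure.map_apply hpm (measurable_pi_apply n hsing)] at h1
      have h0 : markovLaw κ (Measure.dirac s) ((fun ω => ω n) ⁻¹' {cpPath Δ s x n}) = 0 := by
        refine measure_mono_null (fun ω hω => ?_) (ae_iff.1 h)
        intro hall
        have := hall n
        rw [show ω n = cpPath Δ s x n from hω] at this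
        exact hne this
      rw [h0] at h1
      refine hx (measure_mono_null (fun y hy => ?_) h1.symm)
      exact cpPath_congr hA le_rfl hy
    rw [map_frestrictLe_succ, map_frestrictLe_succ, isMarkovLaw_iff.1 (isMarkovLaw_markovLaw κ _),
      map_cpPath_succ hs κ n hstep, ih]

theorem measurable_state_fst : Measurable fun ω : ℕ → CPState d => (ω 0).1 :=
  measurable_fst.comp (measurable_pi_apply 0)

/-- A property that holds almost surely for an ergodic CP-chain holds, for almost every measure `μ`
of the chain, along the path of `μ`-almost every point. -/
theorem IsErgodicCPChain.ae_exists_ae_cpPath {P : Measure (ℕ → CPState d)}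
    (hP : IsErgodicCPChain Δ P) {p : (ℕ → CPState d) → Prop} (hp : ∀ᵐ ω ∂P, p ω) :
    ∀ᵐ μ ∂(measureMarginal P), ∃ A : Box d, IsCPState Δ (μ, A) ∧
      ∀ᵐ x ∂μ, p (cpPath Δ (μ, A) x) := by
  have := hP.isProbabilityMeasure
  obtain ⟨κ, hκ, hκt, hM⟩ := hP.markov
  set P₀ : Measure (CPState d) := P.map fun ω => ω 0 with hP₀
  have : IsProbabilityMeasure P₀ :=
    Measure.isProbabilityMeasure_map (measurable_pi_apply 0).aemeasurable
  have hall : ∀ᵐ ω ∂P, p ω ∧ ∀ n, IsCPState Δ (ω n) ∧ κ (ω n) = cpTransition Δ (ω n) := by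
    filter_upwards [hp, hP.ae_state, hκt] with ω h1 h2 h3 using ⟨h1, fun n => ⟨h2 n, h3 n⟩⟩
  -- Total mass one is a measurable condition and passes to the image measure directly. The rest of
  -- `IsCPState` is recovered below without measurability, because the starting state is an atom of
  -- the process started from it.
  have hprob : ∀ᵐ s ∂P₀, IsProbabilityMeasure s.1 := by
    have hm : MeasurableSet {s : CPState d | s.1 Set.univ = 1} :=
      ((Measure.measurable_coe .univ).comp measurable_fst) (measurableSet_singleton 1)
    have h1 : ∀ᵐ s ∂P₀, s.1 Set.univ = 1 := by
      rw [hP₀, ae_map_iff (f := fun ω : ℕ → CPState d => ω 0)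
        (measurable_pi_apply 0).aemeasurable hm]
      filter_upwards [hP.ae_state] with ω hω
      have := (hω 0).2.2.1
      exact measure_univ
    filter_upwards [h1] with s hs using ⟨hs⟩
  have hstates : ∀ᵐ s ∂P₀, IsCPState Δ s ∧ ∀ᵐ x ∂s.1, p (cpPath Δ s x) := by
    filter_upwards [hM.ae_ae_markovLaw_dirac κ hall, hprob] with s hs hsp
    have hs0 : IsCPState Δ s := by
      by_contra hne
      have hsing := measurableSet_singleton_cpState s
      have h1 := DFunLike.congr_fun (map_zero_markovLaw κ (Measure.dirac s)) {s}
      rw [Measure.map_apply (measurable_pi_apply 0) hsing, Measure.dirac_apply' _ hsing] at h1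
      have h0 : markovLaw κ (Measure.dirac s) ((fun ω => ω 0) ⁻¹' {s}) = 0 := by
        refine measure_mono_null (fun ω hω => ?_) (ae_iff.1 hs)
        intro hω'
        have := (hω'.2 0).1
        rw [show ω 0 = s from hω] at this
        exact hne this
      rw [h0] at h1
      simp at h1
    refine ⟨hs0, ?_⟩
    have hlaw := markovLaw_dirac_eq_map_cpPath hs0 κ (hs.mono fun ω h => h.2)
    rw [hlaw] at hs
    exact (ae_of_ae_map (measurable_cpPath hs0.2.1).aemeasurable hs).mono fun x hx => hx.1
  have hfst : P₀.fst = measureMarginal P := by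
    rw [Measure.fst, hP₀, Measure.map_map measurable_fst (measurable_pi_apply 0)]
    rfl
  -- Disintegrating over the first coordinate gives, for almost every `μ`, almost every box of the
  -- conditional law; one of them is enough.
  rw [← P₀.disintegrate P₀.condKernel] at hstates
  have h2 := Measure.ae_ae_of_ae_compProd hstates
  rw [hfst] at h2
  filter_upwards [h2] with μ hμ
  exact hμ.exists

end PathLaw

/-! ### Entropy as a function of the measure -/

section EntropyMeasurability

variable {X Y : Type*} [MeasurableSpace X]

theorem measurableSet_univ_eq_one : MeasurableSet {ν : Measure X | ν Set.univ = 1} :=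
  Measure.measurable_coe .univ (measurableSet_singleton 1)

open Classical in
/-- The identity on probability measures, as a kernel (which is zero elsewhere). -/
noncomputable def probKernel (X : Type*) [MeasurableSpace X] : Kernel (Measure X) X :=
  Kernel.piecewise (measurableSet_univ_eq_one (X := X)) ⟨id, measurable_id⟩ 0

theorem probKernel_apply (ν : Measure X) [IsProbabilityMeasure ν] : probKernel X ν = ν := by
  classical
  rw [probKernel, Kernel.piecewise_apply, if_pos]
  · rfl
  · exact measure_univ

instance : IsFiniteKernel (probKernel X) := by
  classical
  refine ⟨1, ENNReal.one_lt_top, fun ν => ?_⟩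
  rw [probKernel, Kernel.piecewise_apply]
  split_ifs with h
  · exact le_of_eq h
  · simp

variable [PseudoMetricSpace Y]

/-- The information function of the image of `ν` under `f` at scale `r`. -/
noncomputable def infoAt (f : X → Y) (r : ℝ) (ν : Measure X) (x : X) : ℝ :=
  -Real.log (ν.real (f ⁻¹' Metric.closedBall (f x) r))

variable [MeasurableSpace Y] [OpensMeasurableSpace Y] [SecondCountableTopology Y] {f : X → Y}

theorem measurable_infoAt_probKernel (hf : Measurable f) (r : ℝ) :
    Measurable fun p : Measure X × X => infoAt f r (probKernel X p.1) p.2 := by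
  have hD : MeasurableSet {p : (Measure X × X) × X | dist (f p.2) (f p.1.2) ≤ r} :=
    measurableSet_le ((hf.comp measurable_snd).dist (hf.comp measurable_fst.snd)) measurable_const
  have h := Kernel.measurable_kernel_prodMk_left (κ := (probKernel X).comap
    (Prod.fst : Measure X × X → Measure X) measurable_fst) hD
  exact (Real.measurable_log.comp h.ennreal_toReal).neg

theorem measurable_infoAt (hf : Measurable f) (r : ℝ) (ν : Measure X) [IsProbabilityMeasure ν] :
    Measurable (infoAt f r ν) := by
  have h := (measurable_infoAt_probKernel hf r).comp (measurable_prodMk_left (x := ν))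
  simpa [Function.comp_def, probKernel_apply] using h

theorem ae_measure_preimage_closedBall_pos (hf : Measurable f) {r : ℝ} (hr : 0 < r)
    (ν : Measure X) : ∀ᵐ x ∂ν, 0 < ν (f ⁻¹' Metric.closedBall (f x) r) := by
  have h : ∀ᵐ y ∂(ν.map f), y ∈ (ν.map f).support := Measure.support_mem_ae
  filter_upwards [ae_of_ae_map hf.aemeasurable h] with x hx
  have := (Measure.mem_support_iff_forall (f x)).1 hx _ (Metric.closedBall_mem_nhds (f x) hr)
  rwa [Measure.map_apply hf Metric.isClosed_closedBall.measurableSet] at this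

theorem scaleEntropy_map_eq (hf : Measurable f) (r : ℝ) (ν : Measure X) [IsProbabilityMeasure ν] :
    scaleEntropy r (ν.map f) = ∫⁻ x, ENNReal.ofReal (infoAt f r ν x) ∂ν := by
  have := Measure.isProbabilityMeasure_map (μ := ν) hf.aemeasurable
  have h := measurable_infoAt (f := (id : Y → Y)) measurable_id r (ν.map f)
  rw [scaleEntropy]
  refine (lintegral_map h.ennreal_ofReal hf).trans (lintegral_congr fun x => ?_)
  rw [infoAt, infoAt, Set.preimage_id, id, map_measureReal_apply hf
    Metric.isClosed_closedBall.measurableSet]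

/-- The entropy of the image of `ν` under `f` at scale `r`, with the information function truncated
at height `t`. -/
noncomputable def truncEntropy (f : X → Y) (r t : ℝ) (ν : Measure X) : ℝ≥0∞ :=
  ∫⁻ x, ENNReal.ofReal (min (infoAt f r (probKernel X ν) x) t) ∂(probKernel X ν)

theorem measurable_lintegral_infoAt (hf : Measurable f) (r : ℝ) : Measurable fun ν : Measure X =>
    ∫⁻ x, ENNReal.ofReal (infoAt f r (probKernel X ν) x) ∂(probKernel X ν) :=
  Measurable.lintegral_kernel_prod_right' (κ := probKernel X)
    (measurable_infoAt_probKernel hf r).ennreal_ofReal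

theorem measurable_truncEntropy (hf : Measurable f) (r t : ℝ) :
    Measurable (truncEntropy (X := X) f r t) :=
  Measurable.lintegral_kernel_prod_right' (κ := probKernel X)
    (f := fun p => ENNReal.ofReal (min (infoAt f r (probKernel X p.1) p.2) t))
    ((measurable_infoAt_probKernel hf r).min measurable_const).ennreal_ofReal

omit [MeasurableSpace Y] [OpensMeasurableSpace Y] [SecondCountableTopology Y] in
theorem truncEntropy_le (f : X → Y) (r t : ℝ) (ν : Measure X) :
    truncEntropy f r t ν ≤ ENNReal.ofReal t := by
  have hle : probKernel X ν Set.univ ≤ 1 := by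
    classical
    rw [probKernel, Kernel.piecewise_apply]
    split_ifs with h
    · exact le_of_eq h
    · simp
  calc truncEntropy f r t ν ≤ ∫⁻ _x, ENNReal.ofReal t ∂(probKernel X ν) :=
        lintegral_mono fun x => ENNReal.ofReal_le_ofReal (min_le_right _ _)
    _ ≤ ENNReal.ofReal t := by
        rw [lintegral_const]
        exact mul_le_of_le_one_right' hle

omit [MeasurableSpace Y] [OpensMeasurableSpace Y] [SecondCountableTopology Y] in
theorem truncEntropy_eq (f : X → Y) (r t : ℝ) (ν : Measure X) [IsProbabilityMeasure ν] :
    truncEntropy f r t ν = ∫⁻ x, ENNReal.ofReal (min (infoAt f r ν x) t) ∂ν := by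
  rw [truncEntropy, probKernel_apply]

/-- By monotone convergence, truncating high enough loses arbitrarily little. Bounded information is
what the ergodic theorem and the exponential estimates require. -/
theorem exists_lt_lintegral_truncEntropy (hf : Measurable f) (r : ℝ) {Q : Measure (Measure X)}
    (hQ : ∀ᵐ ν ∂Q, IsProbabilityMeasure ν) {a : ℝ≥0∞}
    (ha : a < ∫⁻ ν, scaleEntropy r (ν.map f) ∂Q) :
    ∃ t : ℕ, a < ∫⁻ ν, truncEntropy f r t ν ∂Q := by
  have hsup : ∀ ν : Measure X, ⨆ t : ℕ, truncEntropy f r t ν =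
      ∫⁻ x, ENNReal.ofReal (infoAt f r (probKernel X ν) x) ∂(probKernel X ν) := by
    intro ν
    have hmeas := (measurable_infoAt_probKernel (X := X) hf r).comp
      (measurable_prodMk_left (x := ν))
    simp only [truncEntropy]
    rw [← lintegral_iSup]
    · refine lintegral_congr fun x => le_antisymm (iSup_le fun t =>
        ENNReal.ofReal_le_ofReal (min_le_left _ _)) ?_
      obtain ⟨t, ht⟩ := exists_nat_ge (infoAt f r (probKernel X ν) x)
      exact le_iSup_of_le t (by rw [min_eq_left ht])
    · exact fun t => (hmeas.min measurable_const).ennreal_ofReal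
    · exact fun s t hst x => ENNReal.ofReal_le_ofReal (min_le_min_left _ (by exact_mod_cast hst))
  have hmono : Monotone fun (t : ℕ) (ν : Measure X) => truncEntropy f r t ν := fun s t hst ν =>
    lintegral_mono fun x => ENNReal.ofReal_le_ofReal (min_le_min_left _ (by exact_mod_cast hst))
  have : ∫⁻ ν, scaleEntropy r (ν.map f) ∂Q = ⨆ t : ℕ, ∫⁻ ν, truncEntropy f r t ν ∂Q := by
    rw [← lintegral_iSup (fun t => measurable_truncEntropy hf r t) hmono]
    refine lintegral_congr_ae ?_
    filter_upwards [hQ] with ν hν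
    rw [hsup, probKernel_apply, scaleEntropy_map_eq hf]
  rw [this] at ha
  exact lt_iSup_iff.1 ha

end EntropyMeasurability

/-! ### Dependence of the entropy on the linear map -/

section LinearMaps

variable {V W : Type*} [NormedAddCommGroup V] [NormedSpace ℝ V] [MeasurableSpace V] [BorelSpace V]
  [NormedAddCommGroup W] [NormedSpace ℝ W] [MeasurableSpace W] [BorelSpace W]
  [SecondCountableTopology W]

/-- On a set of radius `R` the two maps distort differences by at most `r` relative to each other,
so an `r`-ball for `L'` lies in the `2 * r`-ball for `L`. -/
theorem truncEntropy_le_of_norm_sub_le {ν : Measure V} [IsProbabilityMeasure ν] {R : ℝ}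
    (hR : ∀ᵐ x ∂ν, ‖x‖ ≤ R) {L L' : V →L[ℝ] W} {r : ℝ} (hr : 0 < r)
    (h : ‖L - L'‖ * (2 * R) ≤ r) (t : ℝ) :
    truncEntropy L (2 * r) t ν ≤ truncEntropy L' r t ν := by
  rw [truncEntropy_eq, truncEntropy_eq]
  refine lintegral_mono_ae ?_
  filter_upwards [hR, ae_measure_preimage_closedBall_pos L'.continuous.measurable hr ν]
    with x hx hpos
  refine ENNReal.ofReal_le_ofReal (min_le_min_right _ (neg_le_neg (Real.log_le_log ?_ ?_)))
  · exact ENNReal.toReal_pos hpos.ne' (measure_ne_top _ _)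
  · refine ENNReal.toReal_mono (measure_ne_top _ _) (measure_mono_ae ?_)
    filter_upwards [hR] with z hz hz'
    have h1 : ‖L' z - L' x‖ ≤ r := by rw [← dist_eq_norm]; exact hz'
    have h2 : L z - L x = (L' z - L' x) + (L - L') (z - x) := by
      simp only [_root_.sub_apply, map_sub]; abel
    have h3 : ‖(L - L') (z - x)‖ ≤ ‖L - L'‖ * (2 * R) := by
      refine ((L - L').le_opNorm _).trans ?_
      gcongr
      linarith [norm_sub_le z x]
    have h4 : dist (L z) (L x) ≤ 2 * r := by
      rw [dist_eq_norm, h2]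
      linarith [norm_add_le (L' z - L' x) ((L - L') (z - x))]
    exact h4

/-- The radius of the support depends on `ν`, so no single approximation of `L` works for all
measures. Along a sequence tending to `L` the comparison holds eventually for each `ν`, and Fatou's
lemma gives one good member. -/
theorem exists_mem_range_lt_lintegral_truncEntropy {Q : Measure (Measure V)}
    (hQ : ∀ᵐ ν ∂Q, IsProbabilityMeasure ν ∧ ∃ R : ℝ, ∀ᵐ x ∂ν, ‖x‖ ≤ R)
    {ι : Type*} {u : ι → V →L[ℝ] W} (hu : DenseRange u) (L : V →L[ℝ] W) {r t : ℝ} (hr : 0 < r)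
    {a : ℝ≥0∞} (ha : a < ∫⁻ ν, truncEntropy L (2 * r) t ν ∂Q) {η : ℝ} (hη : 0 < η) :
    ∃ j, ‖L - u j‖ ≤ η ∧ a < ∫⁻ ν, truncEntropy (u j) r t ν ∂Q := by
  obtain ⟨v, hv, hvL⟩ := mem_closure_iff_seq_limit.1 (hu L)
  choose j hj using hv
  have hnorm : Tendsto (fun n => ‖L - v n‖) atTop (𝓝 0) := by
    have := (tendsto_const_nhds (x := L)).sub hvL
    rw [sub_self] at this
    exact tendsto_norm_zero.comp this
  have hfatou : ∫⁻ ν, truncEntropy L (2 * r) t ν ∂Q ≤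
      liminf (fun n => ∫⁻ ν, truncEntropy (v n) r t ν ∂Q) atTop := by
    refine le_trans (lintegral_mono_ae ?_) (lintegral_liminf_le fun n =>
      measurable_truncEntropy (v n).continuous.measurable r t)
    filter_upwards [hQ] with ν ⟨hν, R, hR⟩
    refine le_liminf_of_le (by isBoundedDefault) ?_
    have h0 : Tendsto (fun n => ‖L - v n‖ * (2 * R)) atTop (𝓝 0) := by
      simpa using hnorm.mul_const (2 * R)
    filter_upwards [h0.eventually (ge_mem_nhds hr)] with n hn
    exact truncEntropy_le_of_norm_sub_le hR hr hn t
  obtain ⟨n, hn1, hn2⟩ := ((eventually_lt_of_lt_liminf (ha.trans_le hfatou)).and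
    (hnorm.eventually (ge_mem_nhds hη))).exists
  exact ⟨j n, by rwa [hj], by rwa [hj]⟩

end LinearMaps

/-! ### Comparing information gains with entropies of linear images -/

section Comparison

variable {d k : ℕ} {Δ : PartitionOperator d} {s : CPState d} {ρ : ℝ}

theorem isProbabilityMeasure_rescaledMeasure {μ : Measure (Fin d → ℝ)} [IsProbabilityMeasure μ]
    {B : Box d} (h : μ B.toSet ≠ 0) : IsProbabilityMeasure (rescaledMeasure μ B) := by
  have := cond_isProbabilityMeasure h
  exact Measure.isProbabilityMeasure_map B.measurable_rescale.aemeasurable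

/-- If fibres whose images under `g` are close to each other have images under `L ∘ T_D` which are
`r`-close, then the mean information gain over the cell `D` is at least the entropy at scale `r` of
the image under `L` of the rescaled measure. -/
theorem truncEntropy_le_meanInfoGain (hs : IsCPState Δ s) {n q : ℕ} {x : Fin d → ℝ}
    (hx : x ∈ s.2.normalize.toSet) (hpos : s.1 (Δ.cell s.2.normalize n x).toSet ≠ 0)
    {g : (Fin d → ℝ) → (Fin k → ℝ)} {δ : ℝ} (hδ : 0 ≤ δ)
    {L : (Fin d → ℝ) →L[ℝ] (Fin k → ℝ)} {r t : ℝ} (ht : 0 ≤ t)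
    (hgeo : ∀ z ∈ (Δ.cell s.2.normalize n x).toSet,
      ∀ w ∈ nearbyFibers (cellPartition Δ s.2.normalize n) (cellPartition Δ s.2.normalize (n + q))
        g δ z, dist (L ((Δ.cell s.2.normalize n x).rescale w))
          (L ((Δ.cell s.2.normalize n x).rescale z)) ≤ r) :
    (truncEntropy L r t (cpPath Δ s x n).1).toReal ≤
      meanInfoGain s.1 (cellPartition Δ s.2.normalize n)
        (cellPartition Δ s.2.normalize (n + q)) g δ t x := by
  have hμ := hs.2.2.1
  have hA := hs.2.1
  have hr := isRefining_cellPartition hA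
  have hc' := hr.isCountablePartition (n + q)
  have hcc := hr.eq_of_eq n (n + q) (by omega)
  rw [cpPath_fst hs, meanInfoGain, cellPartition_preimage hA hx]
  set D := Δ.cell s.2.normalize n x with hD
  have hDm := D.measurableSet_toSet
  have hprob := isProbabilityMeasure_rescaledMeasure hpos
  have hD0 : 0 < s.1.real D.toSet := ENNReal.toReal_pos hpos (measure_ne_top _ _)
  set I := infoGain s.1 (cellPartition Δ s.2.normalize n) (cellPartition Δ s.2.normalize (n + q))
    g δ t with hI
  refine ENNReal.toReal_le_of_le_ofReal
    (div_nonneg (integral_nonneg fun z => infoGain_nonneg ht z) hD0.le) ?_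
  have hinfo := measurable_infoAt L.continuous.measurable r (rescaledMeasure s.1 D)
  have hmap : ∫⁻ w, ENNReal.ofReal (min (infoAt L r (rescaledMeasure s.1 D) w) t)
      ∂(rescaledMeasure s.1 D) = ∫⁻ z, ENNReal.ofReal (min (infoAt L r (rescaledMeasure s.1 D)
        (D.rescale z)) t) ∂(cond s.1 D.toSet) :=
    lintegral_map (hinfo.min measurable_const).ennreal_ofReal D.measurable_rescale
  rw [truncEntropy_eq, hmap, ProbabilityTheory.cond, lintegral_smul_measure, smul_eq_mul,
    ENNReal.ofReal_div_of_pos hD0, ofReal_measureReal, mul_comm, ← div_eq_mul_inv]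
  refine ENNReal.div_le_div_right ?_ _
  rw [ofReal_integral_eq_lintegral_ofReal (integrable_infoGain ht hc' hcc).integrableOn
    (ae_of_all _ fun z => infoGain_nonneg ht z)]
  refine setLIntegral_mono_ae (measurable_infoGain hc' hcc).ennreal_ofReal.aemeasurable ?_
  filter_upwards [hc'.ae_measure_fiber_ne_zero (μ := s.1)] with z hz hzD
  refine ENNReal.ofReal_le_ofReal (min_le_min_right _ (neg_le_neg ?_))
  have hcz : cellPartition Δ s.2.normalize n z = cellPartition Δ s.2.normalize n x := by
    rw [hD, ← cellPartition_preimage hA hx] at hzD; exact hzD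
  rw [hcz, cellPartition_preimage hA hx, ← hD]
  set N := nearbyFibers (cellPartition Δ s.2.normalize n)
    (cellPartition Δ s.2.normalize (n + q)) g δ z with hN
  have hN0 : 0 < s.1.real N := by
    refine ENNReal.toReal_pos (fun h0 => hz (measure_mono_null (fun w hw => ?_) h0))
      (measure_ne_top _ _)
    have hw' : _ = _ := hw
    exact ⟨hcc _ _ hw', z, z, rfl, hw'.symm, by rw [dist_self]; positivity⟩
  refine Real.log_le_log (by positivity) ?_
  have hball : MeasurableSet (L ⁻¹' Metric.closedBall (L (D.rescale z)) r) :=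
    L.continuous.measurable Metric.isClosed_closedBall.measurableSet
  have hsub : N ⊆ D.toSet ∩ D.rescale ⁻¹' (L ⁻¹' Metric.closedBall (L (D.rescale z)) r) := by
    intro w hw
    refine ⟨?_, hgeo z hzD w hw⟩
    rw [hD, ← cellPartition_preimage hA hx]
    exact hw.1.trans hcz
  rw [rescaledMeasure, map_measureReal_apply D.measurable_rescale hball, measureReal_def (s := _),
    measureReal_def, measureReal_def, cond_apply hDm, ENNReal.toReal_mul, ENNReal.toReal_inv,
    div_eq_inv_mul]
  gcongr
  exact measure_ne_top _ _

theorem dist_le_of_mem_cell {A : Box d} {C : ℝ}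
    (hC : ∀ n : ℕ, 1 ≤ n → ∀ E ∈ Δ.iter A n, (∃ x, Metric.closedBall x (ρ ^ n / C) ⊆ E.toSet) ∧
      (∃ x, E.toSet ⊆ Metric.closedBall x (C * ρ ^ n))) (hA : A ∈ Δ.family) {x u v : Fin d → ℝ}
    (hx : x ∈ A.toSet) {n : ℕ} (hn : 1 ≤ n) (hu : u ∈ (Δ.cell A n x).toSet)
    (hv : v ∈ (Δ.cell A n x).toSet) : ‖u - v‖ ≤ 2 * (C * ρ ^ n) := by
  obtain ⟨y, hy⟩ := (hC n hn _ (PartitionOperator.cell_mem_iter hA hx n)).2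
  have := dist_triangle_right u v y
  rw [← dist_eq_norm]
  linarith [Metric.mem_closedBall.1 (hy hu), Metric.mem_closedBall.1 (hy hv)]

/-- Go from `w` to `v`, to `u`, to `z`. The outer moves stay in cells of generation `n + q`; the
middle one is controlled by the closeness of `g u` and `g v`. Magnifying by at most `C / ρ ^ n`
leaves a multiple of `ρ ^ q`. -/
theorem dist_rescale_le_of_mem_nearbyFibers (hρ0 : 0 < ρ) (hρ1 : ρ < 1) {A : Box d} {C : ℝ}
    (hC1 : 1 < C)
    (hC : ∀ n : ℕ, 1 ≤ n → ∀ E ∈ Δ.iter A n, (∃ x, Metric.closedBall x (ρ ^ n / C) ⊆ E.toSet) ∧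
      (∃ x, E.toSet ⊆ Metric.closedBall x (C * ρ ^ n))) (hA : A ∈ Δ.family) {x : Fin d → ℝ}
    (hx : x ∈ A.toSet) {n q : ℕ} (hn : 1 ≤ n) {g : (Fin d → ℝ) → (Fin k → ℝ)}
    {L L' : (Fin d → ℝ) →L[ℝ] (Fin k → ℝ)}
    (hg : ∀ u ∈ (Δ.cell A n x).toSet, ∀ v ∈ (Δ.cell A n x).toSet,
      ‖g u - g v - L (u - v)‖ ≤ ρ ^ q * ‖u - v‖) (hL : ‖L - L'‖ ≤ ρ ^ q)
    {z w : Fin d → ℝ} (hz : z ∈ (Δ.cell A n x).toSet)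
    (hw : w ∈ nearbyFibers (cellPartition Δ A n) (cellPartition Δ A (n + q)) g (ρ ^ (n + q)) z) :
    dist (L' ((Δ.cell A n x).rescale w)) (L' ((Δ.cell A n x).rescale z)) ≤
      C * (4 * C * (‖L‖ + 1) + 2 + 4 * C) * ρ ^ q := by
  have hC0 : 0 < C := by linarith
  set D := Δ.cell A n x with hD
  obtain ⟨hcw, u, v, hu, hv, huv⟩ := hw
  have hzA : z ∈ A.toSet := PartitionOperator.cell_subset hA hx n hz
  have hcz : cellPartition Δ A n z = cellPartition Δ A n x := by
    rw [hD, ← cellPartition_preimage hA hx] at hz; exact hz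
  have hwD : w ∈ D.toSet := by
    rw [hD, ← cellPartition_preimage hA hx]; exact hcw.trans hcz
  have hwA : w ∈ A.toSet := PartitionOperator.cell_subset hA hx n hwD
  have hr := (isRefining_cellPartition hA).eq_of_eq n (n + q) (by omega)
  have huD : u ∈ D.toSet := by
    rw [hD, ← cellPartition_preimage hA hx]; exact (hr _ _ hu).trans hcz
  have hvD : v ∈ D.toSet := by
    rw [hD, ← cellPartition_preimage hA hx]; exact ((hr _ _ hv).trans hcw).trans hcz
  have huz : u ∈ (Δ.cell A (n + q) z).toSet := by
    rw [← cellPartition_preimage hA hzA]; exact hu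
  have hvw : v ∈ (Δ.cell A (n + q) w).toSet := by
    rw [← cellPartition_preimage hA hwA]; exact hv
  have h1 := dist_le_of_mem_cell hC hA hzA (by omega) (PartitionOperator.mem_cell hA hzA _) huz
  have h2 := dist_le_of_mem_cell hC hA hwA (by omega) hvw (PartitionOperator.mem_cell hA hwA _)
  have h3 := dist_le_of_mem_cell hC hA hx hn huD hvD
  have hscale : D.scale ≤ C / ρ ^ n := by
    obtain ⟨y, hy⟩ := (hC n hn _ (PartitionOperator.cell_mem_iter hA hx n)).1
    have hle : ρ ^ n / C ≤ 1 := by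
      rw [div_le_one hC0]
      exact (pow_le_one₀ hρ0.le hρ1.le).trans hC1.le
    have := Box.scale_le_of_closedBall_subset (by positivity) hle hy
    rwa [inv_div] at this
  have hq1 : ρ ^ q ≤ 1 := pow_le_one₀ hρ0.le hρ1.le
  have hn0 : 0 < ρ ^ n := by positivity
  have hq0 : 0 < ρ ^ q := by positivity
  have hL' : ‖L'‖ ≤ ‖L‖ + 1 := by
    have := norm_sub_norm_le L' L
    rw [norm_sub_rev] at this
    linarith
  rw [dist_eq_norm] at huv
  -- The `2` comes from the images being `2 * ρ ^ (n + q)`-close. Linearizing `g` and replacing `L`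
  -- by `L'` cost `2 * C` each.
  have hLuv : ‖L' (u - v)‖ ≤ (2 + 4 * C) * (ρ ^ n * ρ ^ q) := by
    have e : L' (u - v) = (g u - g v) - (g u - g v - L (u - v)) - (L - L') (u - v) := by
      simp only [_root_.sub_apply]; abel
    have i1 := hg u huD v hvD
    have i2 := (L - L').le_opNorm (u - v)
    have i3 := norm_sub_le ((g u - g v) - (g u - g v - L (u - v))) ((L - L') (u - v))
    have i4 := norm_sub_le (g u - g v) (g u - g v - L (u - v))
    have i5 : ρ ^ q * ‖u - v‖ ≤ ρ ^ q * (2 * (C * ρ ^ n)) := by gcongr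
    have i6 : ‖L - L'‖ * ‖u - v‖ ≤ ρ ^ q * (2 * (C * ρ ^ n)) := by gcongr
    rw [pow_add] at huv
    rw [e]
    linarith
  have hLw : ∀ y : Fin d → ℝ, ‖y‖ ≤ 2 * (C * ρ ^ (n + q)) →
      ‖L' y‖ ≤ 2 * C * (‖L‖ + 1) * (ρ ^ n * ρ ^ q) := by
    intro y hy
    calc ‖L' y‖ ≤ ‖L'‖ * ‖y‖ := L'.le_opNorm y
      _ ≤ (‖L‖ + 1) * (2 * (C * ρ ^ (n + q))) := by gcongr
      _ = _ := by rw [pow_add]; ring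
  have j1 := hLw _ h1
  have j2 := hLw _ h2
  have hsum : ‖L' (w - z)‖ ≤ (4 * C * (‖L‖ + 1) + 2 + 4 * C) * (ρ ^ n * ρ ^ q) := by
    have e : L' (w - z) = -(L' (v - w) + L' (u - v) + L' (z - u)) := by
      simp only [map_sub]; abel
    rw [e, norm_neg]
    have := norm_add_le (L' (v - w) + L' (u - v)) (L' (z - u))
    have := norm_add_le (L' (v - w)) (L' (u - v))
    linarith
  have e : L' (D.rescale w) - L' (D.rescale z) = D.scale • L' (w - z) := by
    rw [← map_sub, ← map_smul, Box.rescale, Box.rescale, ← smul_sub]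
    congr 2
    abel
  rw [dist_eq_norm, e, norm_smul, Real.norm_of_nonneg D.scale_pos.le]
  calc D.scale * ‖L' (w - z)‖
      ≤ C / ρ ^ n * ((4 * C * (‖L‖ + 1) + 2 + 4 * C) * (ρ ^ n * ρ ^ q)) := by gcongr
    _ = _ := by field_simp

end Comparison

/-- Monotonicity interpolates between the scales `y ^ J`, at the price of a constant. -/
theorem exists_le_mul_rpow_of_eventually_le {m : ℝ → ℝ} (hm : Monotone m) (hm1 : ∀ r, m r ≤ 1)
    {y β : ℝ} (hy0 : 0 < y) (hy1 : y < 1) (hβ : 0 ≤ β)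
    (h : ∀ᶠ J : ℕ in atTop, m (y ^ (J + 1)) ≤ (y ^ J) ^ β) :
    ∃ C : ℕ, ∀ r, 0 ≤ r → m r ≤ C * r ^ β := by
  obtain ⟨J₀, hJ₀⟩ := eventually_atTop.1 h
  -- This constant makes the bound trivial for `r ≥ y ^ (J₀ + 2)`, and it also exceeds the loss `(y
  -- ^ 2) ^ (-β)` between `y ^ J` and `y ^ (J + 2)`.
  obtain ⟨C, hC⟩ := exists_nat_ge (((y ^ (J₀ + 2)) ^ β)⁻¹)
  have hb : 0 < (y ^ (J₀ + 2)) ^ β := by positivity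
  have hb1 : (y ^ (J₀ + 2)) ^ β ≤ 1 :=
    Real.rpow_le_one (by positivity) (pow_le_one₀ hy0.le hy1.le) hβ
  have hC1 : (1 : ℝ) ≤ C := ((one_le_inv₀ hb).2 hb1).trans hC
  refine ⟨C, fun r hr => ?_⟩
  rcases hr.eq_or_lt with rfl | hr0
  · rcases hβ.eq_or_lt with rfl | hβ0
    · simpa using (hm1 0).trans hC1
    · rw [Real.zero_rpow hβ0.ne', mul_zero]
      have hlim : Tendsto (fun J : ℕ => (y ^ J) ^ β) atTop (𝓝 0) := by
        have := (tendsto_pow_atTop_nhds_zero_of_lt_one hy0.le hy1).rpow_const (p := β)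
          (.inr hβ0.le)
        rwa [Real.zero_rpow hβ0.ne'] at this
      refine ge_of_tendsto hlim ?_
      filter_upwards [h] with J hJ
      exact (hm (by positivity)).trans hJ
  rcases le_or_gt r 1 with hr1 | hr1
  · obtain ⟨n, hn1, hn2⟩ := exists_nat_pow_near_of_lt_one hr0 hr1 hy0 hy1
    rcases le_or_gt n (J₀ + 1) with hn | hn
    · have h1 : (y ^ (J₀ + 2)) ^ β ≤ r ^ β := by
        refine Real.rpow_le_rpow (by positivity) (le_trans ?_ hn1.le) hβ
        exact pow_le_pow_of_le_one hy0.le hy1.le (by omega)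
      calc m r ≤ 1 := hm1 r
        _ = ((y ^ (J₀ + 2)) ^ β)⁻¹ * (y ^ (J₀ + 2)) ^ β := (inv_mul_cancel₀ hb.ne').symm
        _ ≤ C * r ^ β := by gcongr
    · obtain ⟨J, rfl⟩ : ∃ J, n = J + 1 := ⟨n - 1, by omega⟩
      have h1 : (y ^ (J + 2)) ^ β ≤ r ^ β := Real.rpow_le_rpow (by positivity) hn1.le hβ
      have h2 : (y ^ (J₀ + 2)) ^ β ≤ (y ^ 2) ^ β :=
        Real.rpow_le_rpow (by positivity) (pow_le_pow_of_le_one hy0.le hy1.le (by omega)) hβ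
      have hb2 : 0 < (y ^ 2) ^ β := by positivity
      calc m r ≤ m (y ^ (J + 1)) := hm hn2
        _ ≤ (y ^ J) ^ β := hJ₀ J (by omega)
        _ = ((y ^ 2) ^ β)⁻¹ * (y ^ (J + 2)) ^ β := by
          rw [add_comm J 2, pow_add, Real.mul_rpow (by positivity) (by positivity),
            inv_mul_cancel_left₀ hb2.ne']
        _ ≤ ((y ^ (J₀ + 2)) ^ β)⁻¹ * r ^ β := by gcongr
        _ ≤ C * r ^ β := by gcongr
  · calc m r ≤ 1 := hm1 r
      _ = 1 * 1 := (one_mul 1).symm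
      _ ≤ C * r ^ β := by
        gcongr
        exact Real.one_le_rpow hr1.le hβ

/-! ### Power bounds for image measures at typical points -/

section Local

variable {d k : ℕ} {Δ : PartitionOperator d} {ρ : ℝ} {P : Measure (ℕ → CPState d)}

theorem seqShift_iterate {S : Type*} (i n : ℕ) (ω : ℕ → S) : seqShift^[i] ω n = ω (n + i) := by
  induction i generalizing ω with
  | zero => rfl
  | succ i ih =>
    rw [Function.iterate_succ_apply, ih, seqShift, add_assoc]

/-- The averages of the truncated entropies along the chain are asymptotically bounded below by
their mean. -/
theorem IsErgodicCPChain.ae_eventually_le_sum_truncEntropy (hP : IsErgodicCPChain Δ P)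
    (L : (Fin d → ℝ) →L[ℝ] (Fin k → ℝ)) (r : ℝ) {t a : ℝ} (ha0 : 0 ≤ a) (ht : 0 ≤ t)
    (ha : ENNReal.ofReal a < ∫⁻ ν, truncEntropy L r t ν ∂(measureMarginal P)) :
    ∀ᵐ ω ∂P, ∀ᶠ N : ℕ in atTop,
      a * N ≤ ∑ n ∈ Finset.range N, (truncEntropy L r t (ω n).1).toReal := by
  have := hP.isProbabilityMeasure
  have hm := measurable_truncEntropy (X := Fin d → ℝ) L.continuous.measurable r t
  have hle : ∀ ν : Measure (Fin d → ℝ), truncEntropy L r t ν ≤ ENNReal.ofReal t :=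
    truncEntropy_le _ _ _
  set F : (ℕ → CPState d) → ℝ := fun ω => (truncEntropy L r t (ω 0).1).toReal with hF
  have hFm : Measurable F := (hm.comp measurable_state_fst).ennreal_toReal
  have hint : ∫ ω, F ω ∂P = (∫⁻ ν, truncEntropy L r t ν ∂(measureMarginal P)).toReal := by
    rw [measureMarginal, lintegral_map hm measurable_state_fst]
    exact integral_toReal (hm.comp measurable_state_fst).aemeasurable
      (ae_of_all _ fun ω => (hle _).trans_lt ENNReal.ofReal_lt_top)
  have hfin : ∫⁻ ν, truncEntropy L r t ν ∂(measureMarginal P) ≠ ∞ := by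
    rw [measureMarginal, lintegral_map hm measurable_state_fst]
    refine ne_top_of_le_ne_top (b := ENNReal.ofReal t) ENNReal.ofReal_ne_top
      ((lintegral_mono fun ω => hle _).trans ?_)
    simp
  have haF : a < ∫ ω, F ω ∂P := by
    rw [hint]
    exact (ENNReal.ofReal_lt_iff_lt_toReal ha0 hfin).1 ha
  have h := hP.ergodic.ae_eventually_le_birkhoffSum hFm (B := t) (fun ω => ENNReal.toReal_nonneg)
    (fun ω => ENNReal.toReal_le_of_le_ofReal ht (hle _)) haF
  filter_upwards [h] with ω hω
  filter_upwards [hω] with N hN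
  refine hN.trans (le_of_eq ?_)
  unfold birkhoffSum
  refine Finset.sum_congr rfl fun n _ => ?_
  simp only [hF, seqShift_iterate, zero_add]

theorem IsErgodicCPChain.ae_isProbabilityMeasure_and_bounded (hP : IsErgodicCPChain Δ P) :
    ∀ᵐ ν ∂(measureMarginal P), IsProbabilityMeasure ν ∧ ∃ R : ℝ, ∀ᵐ x ∂ν, ‖x‖ ≤ R := by
  filter_upwards [hP.ae_exists_ae_cpPath (p := fun _ => True) (ae_of_all _ fun _ => trivial)]
    with ν ⟨A, hA, _⟩
  have hν : IsProbabilityMeasure ν := hA.2.2.1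
  refine ⟨hν, ‖A.normalize.lo‖ + ‖A.normalize.hi‖, ?_⟩
  have hmem : A.normalize.toSet ∈ ae ν :=
    (mem_ae_iff_prob_eq_one A.normalize.measurableSet_toSet).2 hA.2.2.2
  filter_upwards [hmem] with x hx
  refine (pi_norm_le_iff_of_nonneg (by positivity)).2 fun i => ?_
  have h1 := Box.le_of_mem hx i
  have h2 := norm_le_pi_norm A.normalize.lo i
  have h3 := norm_le_pi_norm A.normalize.hi i
  rw [Real.norm_eq_abs, abs_le] at *
  constructor <;> linarith [norm_nonneg A.normalize.lo, norm_nonneg A.normalize.hi]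

/-- The sum of the mean information gains exceeds the sum of entropies of the image measures under
a linear map close to the derivative, up to finitely many terms. -/
theorem eventually_truncEntropy_le_meanInfoGain (hρ0 : 0 < ρ) (hρ1 : ρ < 1) {s : CPState d}
    (hs : IsCPState Δ s) {C : ℝ} (hC1 : 1 < C)
    (hC : ∀ n : ℕ, 1 ≤ n → ∀ E ∈ Δ.iter s.2.normalize n,
      (∃ x, Metric.closedBall x (ρ ^ n / C) ⊆ E.toSet) ∧
      (∃ x, E.toSet ⊆ Metric.closedBall x (C * ρ ^ n))) {x : Fin d → ℝ}
    (hx : x ∈ s.2.normalize.toSet) (hpos : ∀ n, s.1 (Δ.cell s.2.normalize n x).toSet ≠ 0)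
    {g : (Fin d → ℝ) → (Fin k → ℝ)} {L L' : (Fin d → ℝ) →L[ℝ] (Fin k → ℝ)}
    (hg : HasStrictFDerivAt g L x) {p q : ℕ} (hL : ‖L - L'‖ ≤ ρ ^ q)
    (hpq : C * (4 * C * (‖L‖ + 1) + 2 + 4 * C) * ρ ^ q ≤ ρ ^ p / 2) {t : ℝ} (ht : 0 ≤ t) :
    ∀ᶠ n : ℕ in atTop, (truncEntropy L' (ρ ^ p / 2) t (cpPath Δ s x n).1).toReal ≤
      meanInfoGain s.1 (cellPartition Δ s.2.normalize n)
        (cellPartition Δ s.2.normalize (n + q)) g (ρ ^ (n + q)) t x := by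
  have hA := hs.2.1
  have hq0 : 0 < ρ ^ q := by positivity
  -- Strict differentiability controls `g u - g v` for any two points of a small cell, without
  -- passing through `x`.
  obtain ⟨ε, hε, hball⟩ := Metric.eventually_nhds_iff_ball.1 (hg.isLittleO.bound hq0)
  have hlim : Tendsto (fun n : ℕ => 2 * (C * ρ ^ n)) atTop (𝓝 0) := by
    have := ((tendsto_pow_atTop_nhds_zero_of_lt_one hρ0.le hρ1).const_mul C).const_mul 2
    simpa using this
  filter_upwards [hlim.eventually (gt_mem_nhds hε), eventually_ge_atTop 1] with n hn hn1
  have hsub : ∀ u ∈ (Δ.cell s.2.normalize n x).toSet, u ∈ Metric.ball x ε := fun u hu => by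
    rw [Metric.mem_ball, dist_eq_norm]
    exact (dist_le_of_mem_cell hC hA hx hn1 hu (PartitionOperator.mem_cell hA hx n)).trans_lt hn
  refine truncEntropy_le_meanInfoGain hs hx (hpos n) (by positivity) ht fun z hz w hw =>
    (dist_rescale_le_of_mem_nearbyFibers hρ0 hρ1 hC1 hC hA hx hn1 (fun u hu v hv => ?_) hL hz
      hw).trans hpq
  refine hball (u, v) ?_
  rw [← ball_prod_same]
  exact ⟨hsub u hu, hsub v hv⟩

/-- For almost every measure of the chain, the image under a differentiable map satisfies a power
bound at almost every point, with any exponent below `cpDim` of the derivative. -/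
theorem IsErgodicCPChain.ae_measure_preimage_closedBall_le (hρ0 : 0 < ρ) (hρ1 : ρ < 1)
    (hΔ : Δ.IsRegular ρ) (hP : IsErgodicCPChain Δ P) :
    ∀ᵐ μ ∂(measureMarginal P), ∀ g : (Fin d → ℝ) → (Fin k → ℝ), Measurable g →
      ∀ᵐ x ∂μ, ∀ L : (Fin d → ℝ) →L[ℝ] (Fin k → ℝ), HasStrictFDerivAt g L x →
        ∀ β : NNReal, (β : ℝ≥0∞) < cpDim P ρ L → ∃ C : ℕ, ∀ r : ℝ, 0 ≤ r →
          μ (g ⁻¹' Metric.closedBall (g x) r) ≤ C * ENNReal.ofReal r ^ (β : ℝ) := by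
  have hQ := hP.ae_isProbabilityMeasure_and_bounded
  set u := TopologicalSpace.denseSeq ((Fin d → ℝ) →L[ℝ] (Fin k → ℝ)) with hu_def
  have hu : DenseRange u := TopologicalSpace.denseRange_denseSeq _
  -- All parameters range over countable sets, so one event of full measure serves every `g` and
  -- every `L`.
  have hergodic : ∀ᵐ ω ∂P, ∀ (j p t : ℕ) (a : ℚ), 0 ≤ a → ENNReal.ofReal a <
      ∫⁻ ν, truncEntropy (u j) (ρ ^ p / 2) t ν ∂(measureMarginal P) →
      ∀ᶠ N : ℕ in atTop, (a : ℝ) * N ≤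
        ∑ n ∈ Finset.range N, (truncEntropy (u j) (ρ ^ p / 2) t (ω n).1).toReal := by
    simp only [ae_all_iff, eventually_imp_distrib_left]
    exact fun j p t a ha0 ha => hP.ae_eventually_le_sum_truncEntropy (u j) _
      (by exact_mod_cast ha0) (Nat.cast_nonneg t) ha
  filter_upwards [hP.ae_exists_ae_cpPath hergodic] with μ ⟨A, hs, hpath⟩ g hg
  have hμ : IsProbabilityMeasure μ := hs.2.2.1
  have hA : A.normalize ∈ Δ.family := hs.2.1
  have href := isRefining_cellPartition hA
  obtain ⟨C, hC1, hC⟩ := hΔ _ hA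
  -- An error `ε = 1` is good enough: it is compared with `α * p * ℓ`, and `p` will be large.
  have hinfo : ∀ᵐ x ∂μ, ∀ q t : ℕ, 0 < q → ∀ a : ℝ, (∀ᶠ N : ℕ in atTop, a * N ≤
      ∑ n ∈ Finset.range N, meanInfoGain μ (cellPartition Δ A.normalize n)
        (cellPartition Δ A.normalize (n + q)) g (ρ ^ (n + q)) t x) →
      ∀ᶠ J : ℕ in atTop, μ.real (g ⁻¹' Metric.closedBall (g x) (ρ ^ ((J + 1) * q))) ≤
        Real.exp (-(a - 1) * J) := by
    simp only [ae_all_iff, eventually_imp_distrib_left]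
    exact fun q t hq => ae_forall_eventually_measureReal_closedBall_le (μ := μ) hρ0 hρ1 href hg
      (Nat.cast_nonneg t) one_pos hq
  have hmem : A.normalize.toSet ∈ ae μ :=
    (mem_ae_iff_prob_eq_one A.normalize.measurableSet_toSet).2 hs.2.2.2
  have hfib : ∀ᵐ x ∂μ, ∀ n, μ (cellPartition Δ A.normalize n ⁻¹'
      {cellPartition Δ A.normalize n x}) ≠ 0 :=
    ae_all_iff.2 fun n => (href.isCountablePartition n).ae_measure_fiber_ne_zero
  filter_upwards [hpath, hinfo, hmem, hfib] with x hxpath hxinfo hxA hxfib L hL β hβ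
  have hpos : ∀ n, μ (Δ.cell A.normalize n x).toSet ≠ 0 := fun n => by
    rw [← cellPartition_preimage hA hxA]; exact hxfib n
  set ℓ := Real.log (1 / ρ) with hℓ
  have hℓ0 : 0 < ℓ := Real.log_pos ((one_lt_div hρ0).2 hρ1)
  obtain ⟨α, hβα, hα⟩ := ENNReal.lt_iff_exists_nnreal_btwn.1 hβ
  have hβα' : (β : ℝ) < α := by exact_mod_cast hβα
  set K := C * (4 * C * (‖L‖ + 1) + 2 + 4 * C) with hK
  have hK0 : 0 < K := by positivity
  -- With `c` extra generations, the distortion `K` is beaten: `K * ρ ^ (p + c) ≤ ρ ^ p / 2` for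
  -- every `p`.
  obtain ⟨c, hc⟩ := exists_pow_lt_of_lt_one (show 0 < 1 / (2 * K) by positivity) hρ1
  have hfreq : ∃ᶠ p : ℕ in atTop, (α : ℝ≥0∞) < meanEntropy P ρ p L :=
    frequently_lt_of_lt_limsup (by isBoundedDefault) hα
  -- This is exactly `β * (p + c) * ℓ ≤ α * p * ℓ - 1`, which pays for the `c` generations and for
  -- the error `1`.
  have hlarge : ∀ᶠ p : ℕ in atTop, (β * c * ℓ + 1) / ((α - β) * ℓ) ≤ p :=
    tendsto_natCast_atTop_atTop.eventually_ge_atTop _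
  obtain ⟨p, hpα, hplarge, hp1⟩ := (hfreq.and_eventually
    (hlarge.and (eventually_ge_atTop 1))).exists
  have hp1' : (1 : ℝ) ≤ p := by exact_mod_cast hp1
  rw [div_le_iff₀ (mul_pos (sub_pos.2 hβα') hℓ0)] at hplarge
  have hpℓ : 0 < p * ℓ := by positivity
  have hent : ENNReal.ofReal (α * (p * ℓ)) <
      ∫⁻ ν, scaleEntropy (ρ ^ p) (ν.map L) ∂(measureMarginal P) := by
    rw [meanEntropy, ENNReal.lt_div_iff_mul_lt (.inl (ENNReal.ofReal_pos.2 hpℓ).ne')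
      (.inl ENNReal.ofReal_ne_top)] at hpα
    rwa [ENNReal.ofReal_mul (NNReal.coe_nonneg α), ENNReal.ofReal_coe_nnreal]
  obtain ⟨t, ht⟩ := exists_lt_lintegral_truncEntropy L.continuous.measurable (ρ ^ p)
    (hQ.mono fun _ h => h.1) hent
  set q := p + c with hq
  have hq0 : 0 < q := by omega
  -- Halving the scale makes room for replacing `L` by a member of the dense sequence.
  have hρp : ρ ^ p = 2 * (ρ ^ p / 2) := by ring
  rw [hρp] at ht
  obtain ⟨j, hj, hjt⟩ := exists_mem_range_lt_lintegral_truncEntropy hQ hu L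
    (show 0 < ρ ^ p / 2 by positivity) ht (show 0 < ρ ^ q by positivity)
  obtain ⟨a', ha'0, ha'1, ha'2⟩ := ENNReal.lt_iff_exists_rat_btwn.1 hjt
  have hαa' : α * (p * ℓ) < a' := by
    have := (ENNReal.ofReal_lt_ofReal_iff_of_nonneg (by positivity)).1 ha'1
    simpa using this
  have hsumF := hxpath j p t a' ha'0 ha'2
  have hpq : K * ρ ^ q ≤ ρ ^ p / 2 := by
    have h1 : K * ρ ^ c ≤ 1 / 2 := by
      have := mul_le_mul_of_nonneg_left hc.le hK0.le
      refine this.trans (le_of_eq ?_)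
      field_simp
    rw [hq, pow_add]
    have h2 : 0 < ρ ^ p := by positivity
    nlinarith
  have hcomp := eventually_truncEntropy_le_meanInfoGain hρ0 hρ1 hs hC1 hC hxA hpos hL hj hpq
    (Nat.cast_nonneg t)
  set F : ℕ → ℝ := fun n => (truncEntropy (u j) (ρ ^ p / 2) t (cpPath Δ (μ, A) x n).1).toReal
  set M : ℕ → ℝ := fun n => meanInfoGain μ (cellPartition Δ A.normalize n)
        (cellPartition Δ A.normalize (n + q)) g (ρ ^ (n + q)) t x
  obtain ⟨n₀, hn₀⟩ := eventually_atTop.1 hcomp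
  have hM0 : ∀ n, 0 ≤ M n := fun n => meanInfoGain_nonneg (Nat.cast_nonneg t) x
  have hFt : ∀ n, F n ≤ t := fun n =>
    ENNReal.toReal_le_of_le_ofReal (Nat.cast_nonneg t) (truncEntropy_le _ _ _ _)
  -- The comparison may fail for finitely many `n`, at a cost of at most `t` each; the gap between
  -- `a'` and `α * (p * ℓ)` absorbs it for large `N`.
  have hFM : ∀ n, F n ≤ M n + if n < n₀ then (t : ℝ) else 0 := fun n => by
    split_ifs with h
    · linarith [hM0 n, hFt n]
    · rw [add_zero]; exact hn₀ n (not_lt.1 h)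
  have hsumM : ∀ᶠ N : ℕ in atTop, α * (p * ℓ) * N ≤ ∑ n ∈ Finset.range N, M n := by
    have hlargeN : ∀ᶠ N : ℕ in atTop, (n₀ * t : ℝ) / (a' - α * (p * ℓ)) ≤ N :=
      tendsto_natCast_atTop_atTop.eventually_ge_atTop _
    filter_upwards [hsumF, hlargeN] with N hN1 hN2
    rw [div_le_iff₀ (sub_pos.2 hαa')] at hN2
    have h1 : ∑ n ∈ Finset.range N, (if n < n₀ then (t : ℝ) else 0) ≤ n₀ * t := by
      rw [← Finset.sum_filter, Finset.sum_const, nsmul_eq_mul]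
      gcongr
      calc _ ≤ (Finset.range n₀).card := Finset.card_le_card fun n hn => by
            simpa using (Finset.mem_filter.1 hn).2
        _ = n₀ := Finset.card_range n₀
    have h2 := Finset.sum_le_sum fun n (_ : n ∈ Finset.range N) => hFM n
    rw [Finset.sum_add_distrib] at h2
    have h3 : (a' : ℝ) * N ≤ ∑ n ∈ Finset.range N, F n := hN1
    nlinarith
  have hdecay := hxinfo q t hq0 _ hsumM
  have hpow : ∀ᶠ J : ℕ in atTop, μ.real (g ⁻¹' Metric.closedBall (g x) ((ρ ^ q) ^ (J + 1))) ≤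
      ((ρ ^ q) ^ J) ^ (β : ℝ) := by
    filter_upwards [hdecay] with J hJ
    rw [← pow_mul, mul_comm q]
    refine hJ.trans ?_
    have hlogρ : Real.log ρ = -ℓ := by rw [hℓ, one_div, Real.log_inv, neg_neg]
    rw [Real.rpow_def_of_pos (by positivity), Real.exp_le_exp, Real.log_pow, Real.log_pow, hlogρ]
    have h1 : (β : ℝ) * q * ℓ ≤ α * (p * ℓ) - 1 := by
      rw [hq]; push_cast; nlinarith
    have h2 := mul_le_mul_of_nonneg_right h1 (Nat.cast_nonneg (α := ℝ) J)
    linarith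
  obtain ⟨B, hB⟩ := exists_le_mul_rpow_of_eventually_le
    (m := fun r => μ.real (g ⁻¹' Metric.closedBall (g x) r))
    (fun r r' hr => measureReal_mono (Set.preimage_mono (Metric.closedBall_subset_closedBall hr)))
    (fun r => measureReal_le_one) (show 0 < ρ ^ q by positivity)
    (pow_lt_one₀ hρ0.le hρ1 hq0.ne') β.2 hpow
  refine ⟨B, fun r hr => ?_⟩
  have h := ENNReal.ofReal_le_ofReal (hB r hr)
  rw [ofReal_measureReal, ENNReal.ofReal_mul (Nat.cast_nonneg B), ENNReal.ofReal_natCast,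
    ← ENNReal.ofReal_rpow_of_nonneg hr β.2] at h
  exact h

end Local

/-! ### Consequences of power bounds for dimension and entropy -/

section PowerBounds

variable {X Y : Type*} [MeasurableSpace X] [MetricSpace Y] [MeasurableSpace Y] [BorelSpace Y]

omit [BorelSpace Y] in
-- Closedness supplies the measurability needed to transfer the power bound from `μ` to its image
-- measure.
theorem isClosed_setOf_forall_measure_closedBall_le (ν : Measure Y) (c : NNReal) (β : NNReal) :
    IsClosed {y | ∀ r : ℝ, 0 ≤ r →
      ν (Metric.closedBall y r) ≤ c * ENNReal.ofReal r ^ (β : ℝ)} := by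
  refine IsSeqClosed.isClosed fun y z hy hz r hr => ?_
  have h0 : Tendsto (fun n => r + dist (y n) z) atTop (𝓝 (r + 0)) :=
    tendsto_const_nhds.add (tendsto_iff_dist_tendsto_zero.1 hz)
  rw [add_zero] at h0
  have h1 : Tendsto (fun n => (c : ℝ≥0∞) * ENNReal.ofReal (r + dist (y n) z) ^ (β : ℝ)) atTop
      (𝓝 (c * ENNReal.ofReal r ^ (β : ℝ))) :=
    ENNReal.Tendsto.const_mul ((ENNReal.continuous_rpow_const.tendsto _).comp
      (ENNReal.tendsto_ofReal h0)) (.inr ENNReal.coe_ne_top)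
  refine ge_of_tendsto' h1 fun n => ?_
  refine (measure_mono (Metric.closedBall_subset_closedBall' ?_)).trans
    (hy n (r + dist (y n) z) (by positivity))
  rw [dist_comm z]

theorem le_lowerHausdorffDim_map_of_ae_measure_preimage_closedBall_le {μ : Measure X} {f : X → Y}
    (hf : Measurable f) {β : NNReal} (h : ∀ᵐ x ∂μ, ∃ C : ℕ, ∀ r : ℝ, 0 ≤ r →
      μ (f ⁻¹' Metric.closedBall (f x) r) ≤ C * ENNReal.ofReal r ^ (β : ℝ)) :
    (β : ℝ≥0∞) ≤ lowerHausdorffDim (μ.map f) := by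
  refine le_lowerHausdorffDim_of_ae_measure_closedBall_le ?_
  rw [ae_map_iff hf.aemeasurable]
  · simpa only [Measure.map_apply hf Metric.isClosed_closedBall.measurableSet] using h
  · rw [Set.ofPred_exists]
    exact .iUnion fun C => by
      simpa using (isClosed_setOf_forall_measure_closedBall_le (μ.map f) C β).measurableSet

omit [MeasurableSpace Y] [BorelSpace Y] in
theorem le_liminf_infoAt_div {ρ : ℝ} (hρ0 : 0 < ρ) (hρ1 : ρ < 1) {ν : Measure X}
    [IsProbabilityMeasure ν] {f : X → Y} {x : X} {s : ℝ≥0∞}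
    (hpos : ∀ q : ℕ, 0 < ν (f ⁻¹' Metric.closedBall (f x) (ρ ^ q)))
    (h : ∀ β : NNReal, (β : ℝ≥0∞) < s → ∃ C : ℕ, ∀ r : ℝ, 0 ≤ r →
      ν (f ⁻¹' Metric.closedBall (f x) r) ≤ C * ENNReal.ofReal r ^ (β : ℝ)) :
    s ≤ liminf (fun q : ℕ => ENNReal.ofReal (infoAt f (ρ ^ q) ν x) /
      ENNReal.ofReal (q * Real.log (1 / ρ))) atTop := by
  set ℓ := Real.log (1 / ρ) with hℓ
  have hℓ0 : 0 < ℓ := Real.log_pos ((one_lt_div hρ0).2 hρ1)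
  have hlogρ : Real.log ρ = -ℓ := by rw [hℓ, one_div, Real.log_inv, neg_neg]
  refine ENNReal.le_of_forall_nnreal_lt fun β hβ => le_liminf_of_le (by isBoundedDefault) ?_
  obtain ⟨α, hβα, hα⟩ := ENNReal.lt_iff_exists_nnreal_btwn.1 hβ
  have hβα' : (β : ℝ) < α := by exact_mod_cast hβα
  obtain ⟨C, hC⟩ := h α hα
  filter_upwards [tendsto_natCast_atTop_atTop.eventually_ge_atTop (Real.log C / ((α - β) * ℓ)),
    eventually_ge_atTop 1] with q hq hq1
  rw [div_le_iff₀ (mul_pos (sub_pos.2 hβα') hℓ0)] at hq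
  have hq1' : (1 : ℝ) ≤ q := by exact_mod_cast hq1
  have hqℓ : 0 < q * ℓ := by positivity
  rw [ENNReal.le_div_iff_mul_le (.inl (ENNReal.ofReal_pos.2 hqℓ).ne') (.inl ENNReal.ofReal_ne_top),
    ← ENNReal.ofReal_coe_nnreal, ← ENNReal.ofReal_mul (NNReal.coe_nonneg β)]
  refine ENNReal.ofReal_le_ofReal ?_
  have hρq : 0 < ρ ^ q := by positivity
  have hm := hC (ρ ^ q) hρq.le
  -- The ball has positive mass, which excludes `C = 0` before logarithms are taken.
  have hC0 : (C : ℝ) ≠ 0 := by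
    rintro hC0
    rw [Nat.cast_eq_zero] at hC0
    rw [hC0, Nat.cast_zero, zero_mul] at hm
    exact (hpos q).not_ge hm
  rw [ENNReal.ofReal_rpow_of_pos hρq, ← ENNReal.ofReal_natCast,
    ← ENNReal.ofReal_mul (Nat.cast_nonneg C)] at hm
  have hm' : ν.real (f ⁻¹' Metric.closedBall (f x) (ρ ^ q)) ≤ C * (ρ ^ q) ^ (α : ℝ) :=
    ENNReal.toReal_le_of_le_ofReal (by positivity) hm
  have hlog := Real.log_le_log (ENNReal.toReal_pos (hpos q).ne' (measure_ne_top _ _)) hm'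
  rw [Real.log_mul hC0 (by positivity), Real.log_rpow hρq, Real.log_pow, hlogρ] at hlog
  rw [infoAt]
  have : ν.real (f ⁻¹' Metric.closedBall (f x) (ρ ^ q)) =
    (ν (f ⁻¹' Metric.closedBall (f x) (ρ ^ q))).toReal := rfl
  rw [this]
  linarith

end PowerBounds

/-! ### Convergence of the entropies and the dimension bound -/

section Final

variable {d k : ℕ} {Δ : PartitionOperator d} {ρ : ℝ} {P : Measure (ℕ → CPState d)}

theorem IsErgodicCPChain.meanEntropy_eq_lintegral_infoAt (hP : IsErgodicCPChain Δ P) (ρ : ℝ)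
    (q : ℕ) (L : (Fin d → ℝ) →L[ℝ] (Fin k → ℝ)) :
    meanEntropy P ρ q L = ∫⁻ ν, ∫⁻ x, ENNReal.ofReal (infoAt L (ρ ^ q) (probKernel _ ν) x) /
      ENNReal.ofReal (q * Real.log (1 / ρ)) ∂(probKernel _ ν) ∂(measureMarginal P) := by
  have hL : Measurable L := L.continuous.measurable
  rw [meanEntropy]
  generalize ENNReal.ofReal (q * Real.log (1 / ρ)) = c
  simp only [div_eq_mul_inv]
  have h : ∀ᵐ ν ∂(measureMarginal P), scaleEntropy (ρ ^ q) (ν.map L) =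
      ∫⁻ x, ENNReal.ofReal (infoAt L (ρ ^ q) (probKernel _ ν) x) ∂(probKernel _ ν) := by
    filter_upwards [hP.ae_isProbabilityMeasure_and_bounded] with ν ⟨hν, _⟩
    rw [probKernel_apply, scaleEntropy_map_eq hL]
  rw [lintegral_congr_ae h, ← lintegral_mul_const _ (measurable_lintegral_infoAt hL _)]
  refine lintegral_congr_ae ?_
  filter_upwards [hP.ae_isProbabilityMeasure_and_bounded] with ν ⟨hν, _⟩
  rw [probKernel_apply, lintegral_mul_const _ (measurable_infoAt hL _ ν).ennreal_ofReal]

/-- The power bounds for the linear map itself hold for every exponent below the upper limit. Hence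
the normalized information has lower limit at least that value almost everywhere, and Fatou's lemma,
in `x` and in `ν`, brings this to the means. -/
theorem IsErgodicCPChain.tendsto_meanEntropy (hρ0 : 0 < ρ) (hρ1 : ρ < 1)
    (hΔ : Δ.IsRegular ρ) (hP : IsErgodicCPChain Δ P) (L : (Fin d → ℝ) →L[ℝ] (Fin k → ℝ)) :
    Tendsto (fun q : ℕ => meanEntropy P ρ q L) atTop (𝓝 (cpDim P ρ L)) := by
  have := hP.isProbabilityMeasure
  have hprob : IsProbabilityMeasure (measureMarginal P) :=
    Measure.isProbabilityMeasure_map measurable_state_fst.aemeasurable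
  have hLm : Measurable L := L.continuous.measurable
  have hFm : ∀ q : ℕ, Measurable fun p : Measure (Fin d → ℝ) × (Fin d → ℝ) =>
      ENNReal.ofReal (infoAt L (ρ ^ q) (probKernel _ p.1) p.2) /
        ENNReal.ofReal (q * Real.log (1 / ρ)) := fun q =>
    (measurable_infoAt_probKernel hLm _).ennreal_ofReal.div_const _
  have hae : ∀ᵐ ν ∂(measureMarginal P), cpDim P ρ L ≤ liminf (fun q : ℕ =>
      ∫⁻ x, ENNReal.ofReal (infoAt L (ρ ^ q) (probKernel _ ν) x) /
        ENNReal.ofReal (q * Real.log (1 / ρ)) ∂(probKernel _ ν)) atTop := by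
    filter_upwards [hP.ae_measure_preimage_closedBall_le (k := k) hρ0 hρ1 hΔ,
      hP.ae_isProbabilityMeasure_and_bounded] with ν hν ⟨hν1, _⟩
    rw [probKernel_apply]
    refine le_trans ?_ (lintegral_liminf_le fun q =>
      (measurable_infoAt hLm _ ν).ennreal_ofReal.div_const _)
    have hpos : ∀ᵐ x ∂ν, ∀ q : ℕ, 0 < ν (L ⁻¹' Metric.closedBall (L x) (ρ ^ q)) :=
      ae_all_iff.2 fun q => ae_measure_preimage_closedBall_pos hLm (by positivity) ν
    calc cpDim P ρ L = ∫⁻ _, cpDim P ρ L ∂ν := by simp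
      _ ≤ _ := lintegral_mono_ae ?_
    filter_upwards [hν L hLm, hpos] with x hx hxpos
    exact le_liminf_infoAt_div hρ0 hρ1 hxpos (hx L L.hasStrictFDerivAt)
  refine tendsto_of_le_liminf_of_limsup_le ?_ le_rfl
  simp only [hP.meanEntropy_eq_lintegral_infoAt]
  refine le_trans ?_ (lintegral_liminf_le fun q =>
    Measurable.lintegral_kernel_prod_right' (κ := probKernel _) (hFm q))
  calc cpDim P ρ L = ∫⁻ _, cpDim P ρ L ∂(measureMarginal P) := by simp
    _ ≤ _ := lintegral_mono_ae hae

theorem IsErgodicCPChain.ae_essInf_le_lowerHausdorffDim_map (hρ0 : 0 < ρ) (hρ1 : ρ < 1)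
    (hΔ : Δ.IsRegular ρ) (hP : IsErgodicCPChain Δ P) :
    ∀ᵐ μ ∂(measureMarginal P), ∀ (U : Set (Fin d → ℝ)) (g : (Fin d → ℝ) → (Fin k → ℝ)),
      IsOpen U → μ.support ⊆ U → ContDiffOn ℝ 1 g U →
      essInf (fun x => cpDim P ρ (fderiv ℝ g x)) μ ≤ lowerHausdorffDim (μ.map g) := by
  filter_upwards [hP.ae_measure_preimage_closedBall_le (k := k) hρ0 hρ1 hΔ] with μ hμ U g hU hμU hg
  classical
  -- Off `U` nothing is known about `g`, not even measurability. The modification is Borel, agrees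
  -- with `g` almost everywhere, and has the same germ, hence the same derivative, at each point of
  -- `U`.
  set g' : (Fin d → ℝ) → (Fin k → ℝ) := U.piecewise g 0 with hg'
  have hg'm : Measurable g' := by
    refine measurable_of_restrict_of_restrict_compl hU.measurableSet ?_ ?_
    · rw [hg', Set.domRestrict_piecewise]
      exact hg.continuousOn.domRestrict.measurable
    · rw [hg', Set.domRestrict_piecewise_compl]
      exact measurable_const
  have hUae : ∀ᵐ x ∂μ, x ∈ U := by
    filter_upwards [Measure.support_mem_ae (μ := μ)] with x hx using hμU hx
  have heq : g =ᵐ[μ] g' := by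
    filter_upwards [hUae] with x hx
    rw [hg', Set.piecewise_eq_of_mem _ _ _ hx]
  rw [Measure.map_congr heq]
  refine ENNReal.le_of_forall_nnreal_lt fun β hβ => ?_
  refine le_lowerHausdorffDim_map_of_ae_measure_preimage_closedBall_le hg'm ?_
  filter_upwards [hμ g' hg'm, hUae, ae_lt_of_lt_essInf hβ] with x hx hxU hxβ
  refine hx _ ?_ β hxβ
  have hnhds := hU.mem_nhds hxU
  refine ((hg.contDiffAt hnhds).hasStrictFDerivAt one_ne_zero).congr_of_eventuallyEq ?_
  filter_upwards [hnhds] with y hy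
  rw [hg', Set.piecewise_eq_of_mem _ _ _ hy]

end Final

theorem mainTheorem10 {d k : ℕ} {ρ : ℝ} (hρ0 : 0 < ρ) (hρ1 : ρ < 1)
    (Δ : PartitionOperator d) (hΔ : Δ.IsRegular ρ)
    (P : Measure (ℕ → CPState d)) (hP : IsErgodicCPChain Δ P) :
    (∀ L : (Fin d → ℝ) →L[ℝ] (Fin k → ℝ), Function.Surjective L →
      Tendsto (fun q : ℕ => meanEntropy P ρ q L) atTop (𝓝 (cpDim P ρ L))) ∧
    ∀ᵐ μ ∂(measureMarginal P), ∀ (U : Set (Fin d → ℝ)) (g : (Fin d → ℝ) → (Fin k → ℝ)),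
      IsOpen U → μ.support ⊆ U → ContDiffOn ℝ 1 g U →
      (∀ x ∈ μ.support, Function.Surjective (fderiv ℝ g x)) →
      essInf (fun x => cpDim P ρ (fderiv ℝ g x)) μ ≤ lowerHausdorffDim (μ.map g) := by
  refine ⟨fun L _ => hP.tendsto_meanEntropy hρ0 hρ1 hΔ L, ?_⟩
  filter_upwards [hP.ae_essInf_le_lowerHausdorffDim_map hρ0 hρ1 hΔ] with μ hμ U g hU hμU hg _
  exact hμ U g hU hμU hg
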